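/- **Conventions.** Graphs are finite and simple, and $[n]=\{1,\dots,n\}$. An *FI-graph* $G_\bullet$ is a functor from the category of the sets $[n]$ ($n\ge 0$) with injections to the category of graphs with graph homomorphisms; in particular $\mathfrak S_n$ acts on $G_n$. It is *finitely generated* if for all $n\gg0$ every vertex of $G_{n+1}$ is $G_f(w)$ for some vertex $w$ of $G_n$ and some injection $f:[n]\to[n+1]$. It is *vertex-quadratic* if there are $a,b,c\in\mathbb Q$ with $|V(G_n)|=an^2+bn+c$ for all $n\gg0$ ($a=0$ is allowed). A *classification graph* $\mathfrak C$ is a finite multigraph, with loops allowed, whose vertices are labelled $v^{(1)},v^{(2)},v^{(3)}$ or $v^{(4)}$ and whose loops and edges carry labels from the list below, according to the labels of their ends. Parallel edges, and loops at the same vertex, have different labels, except that the directed label $e^{(1,1)}_2$ may occur twice between two vertices, once in each direction. For $n\ge0$ the graph $\mathfrak f(\mathfrak C,n)$, with its action of $\mathfrak S_n$, is obtained by replacing each vertex labelled $v^{(1)}$ by a copy of $\{(a,b): a\ne b\in[n]\}$ (an ordered-pair orbit), $v^{(2)}$ by a copy of the set of two-element subsets of $[n]$, $v^{(3)}$ by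 a copy of $[n]$, and $v^{(4)}$ by a single invariant vertex, and by joining points as follows. * Loops, joining points $x\ne y$ of one orbit. At $v^{(1)}$ with $x=(a,b)$, $y=(c,d)$: $e^{(1)}_1$: $\{a,b\}\cap\{c,d\}=\emptyset$; $e^{(1)}_2$: $a=c$, $b\ne d$; $e^{(1)}_3$: $a\ne c$, $b=d$; $e^{(1)}_4$: either $b=c$, $a\ne d$, or $a=d$, $b\ne c$; $e^{(1)}_5$: $(c,d)=(b,a)$. At $v^{(2)}$: $e^{(2)}_1$: $|x\cap y|=0$; $e^{(2)}_2$: $|x\cap y|=1$. At $v^{(3)}$: $e^{(3)}_1$: all $x\neq y$. There are no loops at $v^{(4)}$. * Between two distinct vertices labelled $v^{(1)}$, with $x=(a,b)$ in the first orbit and $y=(c,d)$ in the second: $e^{(1,1)}_1$: $\{a,b\}\cap\{c,d\}=\emptyset$; $e^{(1,1)}_2$ (directed from the first to the second): $a=d$, $b\ne c$; $e^{(1,1)}_3$: $a=c$, $b\neq d$; $e^{(1,1)}_4$: $a\ne c$, $b=d$; $e^{(1,1)}_5$: $(c,d)=(a,b)$; $e^{(1,1)}_6$: $(c,d)=(b,a)$.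 * Between $v^{(1)}$ and $v^{(2)}$, with $x=(a,b)$ and $y$ a two-element set: $e^{(1,2)}_1$: $a,b\notin y$; $e^{(1,2)}_2$: $a\in y$, $b\notin y$; $e^{(1,2)}_3$: $a\notin y$, $b\in y$; $e^{(1,2)}_4$: $a,b\in y$. Between $v^{(1)}$ and $v^{(3)}$, with $y=c$: $e^{(1,3)}_1$: $c\notin\{a,b\}$; $e^{(1,3)}_2$: $c=a$; $e^{(1,3)}_3$: $c=b$. * Between two vertices $v^{(2)}$: $e^{(2,2)}_j$ ($j=1,2,3$): $|x\cap y|=j-1$. Between $v^{(2)}$ and $v^{(3)}$, with $y=c$: $e^{(2,3)}_1$: $c\notin x$; $e^{(2,3)}_2$: $c\in x$. Between two vertices $v^{(3)}$: $e^{(3,3)}_1$: $x\ne y$ as elements of $[n]$; $e^{(3,3)}_2$: $x=y$ as elements of $[n]$. * Between any vertex $v^{(k)}$ and another vertex $v^{(4)}$: $e^{(k,4)}_1$: all $x,y$. Two classification graphs $\mathfrak C,\mathfrak D$ are *isomorphic* if there are a set $R$ of vertices of $\mathfrak C$ labelled $v^{(1)}$ and a bijection from the vertices of $\mathfrak C$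 to those of $\mathfrak D$ which preserves the vertex labels and carries the labelled (and directed) loops and edges of $\mathfrak C$, after the change of labels that results from renaming the points $(a,b)\mapsto(b,a)$ in the orbits of the vertices in $R$, onto those of $\mathfrak D$. (For a loop at a vertex in $R$ this change interchanges $e^{(1)}_2$ and $e^{(1)}_3$, and it is analogous for the other labels. If there is no vertex $v^{(1)}$, this is an isomorphism of multigraphs preserving all labels.) **Theorem 4.3.** Let $G_\bullet$ be a finitely generated vertex-quadratic FI-graph. Then there is a classification graph $\mathfrak C$, unique up to isomorphism, such that for all $n\gg0$ there is an $\mathfrak S_n$-equivariant isomorphism of graphs $\mathfrak f(\mathfrak C,n)\cong G_n$. More precisely, a classification graph $\mathfrak D$ also has $\mathfrak S_n$-equivariant isomorphisms $\mathfrak f(\mathfrak D,n)\cong G_n$ for all $n\gg0$ if and only if $\mathfrak D$ is isomorphic to $\mathfrak C$. -/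

import Mathlib

open Filter

universe u

/-- An FI-graph: a functor from the category of the finite sets `[n] = Fin n` (`n ≥ 0`) with
injections to the category of finite simple graphs with graph homomorphisms. -/
structure FIGraph where
  /-- the vertex set of `G_n` -/
  V : ℕ → Type u
  finite : ∀ n, Finite (V n)
  /-- the graph `G_n` -/
  graph : ∀ n, SimpleGraph (V n)
  /-- the graph homomorphism `G_f` induced by an injection `f` -/
  map : ∀ {m n : ℕ}, (Fin m ↪ Fin n) → (graph m →g graph n)
  map_refl : ∀ (n : ℕ) (v : V n), map (Function.Embedding.refl (Fin n)) v = v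
  map_trans : ∀ {l m n : ℕ} (f : Fin l ↪ Fin m) (g : Fin m ↪ Fin n) (v : V l),
    map (f.trans g) v = map g (map f v)

namespace FIGraph

/-- For all large `n`, every vertex of `G_{n+1}` is the image of a vertex of `G_n` under the map
induced by some injection `[n] → [n+1]`. -/
def FinitelyGenerated (G : FIGraph.{u}) : Prop :=
  ∀ᶠ n in atTop, ∀ v : G.V (n + 1), ∃ (w : G.V n) (f : Fin n ↪ Fin (n + 1)), G.map f w = v

/-- For all large `n`, the number of vertices of `G_n` is a polynomial in `n` of degree at
most two. -/
def VertexQuadratic (G : FIGraph.{u}) : Prop :=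
  ∃ a b c : ℚ, ∀ᶠ n : ℕ in atTop, (Nat.card (G.V n) : ℚ) = a * (n : ℚ) ^ 2 + b * (n : ℚ) + c

end FIGraph

/-- The labels `v^{(1)}`, `v^{(2)}`, `v^{(3)}`, `v^{(4)}` of the vertices of a classification
graph. -/
inductive VertexLabel
  | /-- `v^{(1)}`: an orbit of ordered pairs of distinct elements of `[n]` -/ ordered
  | /-- `v^{(2)}`: an orbit of unordered pairs -/ unordered
  | /-- `v^{(3)}`: an orbit that is a copy of `[n]` -/ linear
  | /-- `v^{(4)}`: an orbit that is a single invariant vertex -/ singleton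

/-- The labels of the loops and of the edges between distinct vertices of a classification graph.
The relation of points which each of them stands for is `EdgeLabel.Rel`. -/
inductive EdgeLabel
  -- the five loops `e_j^{(1)}`
  | ordLoopDisjoint
  | ordLoopFirst
  | ordLoopSecond
  | ordLoopChain
  | ordLoopSwap
  -- the two loops `e_j^{(2)}`
  | unordLoopDisjoint
  | unordLoopShare
  -- the loop `e_1^{(3)}`
  | linLoop
  -- the six labels `e_j^{(1,1)}`, of which the second, `ordOrdFirstSecond`, is directed
  | ordOrdDisjoint
  | ordOrdFirstSecond
  | ordOrdFirst
  | ordOrdSecond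
  | ordOrdSame
  | ordOrdSwap
  -- the four labels `e_j^{(1,2)}`
  | ordUnordDisjoint
  | ordUnordFirst
  | ordUnordSecond
  | ordUnordBoth
  -- the three labels `e_j^{(1,3)}`
  | ordLinDisjoint
  | ordLinFirst
  | ordLinSecond
  -- the three labels `e_j^{(2,2)}`
  | unordUnordDisjoint
  | unordUnordShare
  | unordUnordSame
  -- the two labels `e_j^{(2,3)}`
  | unordLinDisjoint
  | unordLinShare
  -- the two labels `e_j^{(3,3)}`
  | linLinDistinct
  | linLinEqual
  -- the labels `e_1^{(x,4)}`, `x = 1, 2, 3, 4`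
  | ordSing
  | unordSing
  | linSing
  | singSing

namespace EdgeLabel

/-- The vertex labels at the two ends of an edge with a given label. -/
def ends : EdgeLabel → Sym2 VertexLabel
  | ordLoopDisjoint | ordLoopFirst | ordLoopSecond | ordLoopChain | ordLoopSwap =>
      s(.ordered, .ordered)
  | unordLoopDisjoint | unordLoopShare => s(.unordered, .unordered)
  | linLoop => s(.linear, .linear)
  | ordOrdDisjoint | ordOrdFirstSecond | ordOrdFirst | ordOrdSecond | ordOrdSame | ordOrdSwap =>
      s(.ordered, .ordered)
  | ordUnordDisjoint | ordUnordFirst | ordUnordSecond | ordUnordBoth => s(.ordered, .unordered)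
  | ordLinDisjoint | ordLinFirst | ordLinSecond => s(.ordered, .linear)
  | unordUnordDisjoint | unordUnordShare | unordUnordSame => s(.unordered, .unordered)
  | unordLinDisjoint | unordLinShare => s(.unordered, .linear)
  | linLinDistinct | linLinEqual => s(.linear, .linear)
  | ordSing => s(.ordered, .singleton)
  | unordSing => s(.unordered, .singleton)
  | linSing => s(.linear, .singleton)
  | singSing => s(.singleton, .singleton)

/-- The labels of loops; all others are labels of edges between two distinct vertices. -/
def IsLoop : EdgeLabel → Prop
  | ordLoopDisjoint | ordLoopFirst | ordLoopSecond | ordLoopChain | ordLoopSwap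
  | unordLoopDisjoint | unordLoopShare | linLoop => True
  | _ => False

end EdgeLabel

/-- A vertex-quadratic classification graph: a finite labelled multigraph with loops.
Two edges with the same ends and the same label (and the same direction, for the directed label)
are not allowed, so the edges are recorded by a relation `HasEdge ℓ u v`: there is an edge
labelled `ℓ` between `u` and `v`, directed from `u` to `v` if `ℓ` is the directed label. -/
structure ClassificationGraph where
  V : Type
  finite : Finite V
  label : V → VertexLabel
  HasEdge : EdgeLabel → V → V → Prop
  ends_eq : ∀ {ℓ : EdgeLabel} {u v : V}, HasEdge ℓ u v → ℓ.ends = s(label u, label v)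
  isLoop_iff : ∀ {ℓ : EdgeLabel} {u v : V}, HasEdge ℓ u v → (ℓ.IsLoop ↔ u = v)
  symm : ∀ {ℓ : EdgeLabel} {u v : V}, ℓ ≠ .ordOrdFirstSecond → HasEdge ℓ u v → HasEdge ℓ v u

/-- The possible names, for a given `n`, of the points of an orbit. -/
inductive Point (n : ℕ)
  | ordPair (a b : Fin n) (h : a ≠ b)
  | unordPair (s : Finset (Fin n)) (h : s.card = 2)
  | elem (a : Fin n)
  | pt

namespace Point

/-- The kind of orbit a point belongs to. -/
def label {n : ℕ} : Point n → VertexLabel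
  | ordPair _ _ _ => .ordered
  | unordPair _ _ => .unordered
  | elem _ => .linear
  | pt => .singleton

/-- The permutation action of `S_n` on points. -/
def act {n : ℕ} (σ : Equiv.Perm (Fin n)) : Point n → Point n
  | ordPair a b h => ordPair (σ a) (σ b) (σ.injective.ne h)
  | unordPair s h => unordPair (s.map σ.toEmbedding) (by rw [Finset.card_map, h])
  | elem a => elem (σ a)
  | pt => pt

theorem label_act {n : ℕ} (σ : Equiv.Perm (Fin n)) (x : Point n) :
    (x.act σ).label = x.label := by
  cases x <;> rfl

end Point

/-- The pairs of points which an edge with a given label connects. For an edge between orbits of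
different kinds the first argument lies in the orbit named first in the label; for the directed
label the first argument lies in the orbit at the source. (It is enough to list each pair of
points in one of the two orders, since the graph below is the symmetric closure.) -/
def EdgeLabel.Rel {n : ℕ} : EdgeLabel → Point n → Point n → Prop
  | .ordLoopDisjoint, .ordPair a b _, .ordPair c d _ => a ≠ c ∧ a ≠ d ∧ b ≠ c ∧ b ≠ d
  | .ordLoopFirst, .ordPair a b _, .ordPair c d _ => a = c ∧ b ≠ d
  | .ordLoopSecond, .ordPair a b _, .ordPair c d _ => a ≠ c ∧ b = d
  | .ordLoopChain, .ordPair a b _, .ordPair c d _ => b = c ∧ a ≠ d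
  | .ordLoopSwap, .ordPair a b _, .ordPair c d _ => a = d ∧ b = c
  | .unordLoopDisjoint, .unordPair s _, .unordPair t _ => (s ∩ t).card = 0
  | .unordLoopShare, .unordPair s _, .unordPair t _ => (s ∩ t).card = 1
  | .linLoop, .elem a, .elem b => a ≠ b
  | .ordOrdDisjoint, .ordPair a b _, .ordPair c d _ => a ≠ c ∧ a ≠ d ∧ b ≠ c ∧ b ≠ d
  | .ordOrdFirstSecond, .ordPair a b _, .ordPair c d _ => a = d ∧ b ≠ c
  | .ordOrdFirst, .ordPair a b _, .ordPair c d _ => a = c ∧ b ≠ d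
  | .ordOrdSecond, .ordPair a b _, .ordPair c d _ => a ≠ c ∧ b = d
  | .ordOrdSame, .ordPair a b _, .ordPair c d _ => a = c ∧ b = d
  | .ordOrdSwap, .ordPair a b _, .ordPair c d _ => a = d ∧ b = c
  | .ordUnordDisjoint, .ordPair a b _, .unordPair s _ => a ∉ s ∧ b ∉ s
  | .ordUnordFirst, .ordPair a b _, .unordPair s _ => a ∈ s ∧ b ∉ s
  | .ordUnordSecond, .ordPair a b _, .unordPair s _ => a ∉ s ∧ b ∈ s
  | .ordUnordBoth, .ordPair a b _, .unordPair s _ => a ∈ s ∧ b ∈ s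
  | .ordLinDisjoint, .ordPair a b _, .elem c => a ≠ c ∧ b ≠ c
  | .ordLinFirst, .ordPair a _ _, .elem c => a = c
  | .ordLinSecond, .ordPair _ b _, .elem c => b = c
  | .unordUnordDisjoint, .unordPair s _, .unordPair t _ => (s ∩ t).card = 0
  | .unordUnordShare, .unordPair s _, .unordPair t _ => (s ∩ t).card = 1
  | .unordUnordSame, .unordPair s _, .unordPair t _ => (s ∩ t).card = 2
  | .unordLinDisjoint, .unordPair s _, .elem a => a ∉ s
  | .unordLinShare, .unordPair s _, .elem a => a ∈ s
  | .linLinDistinct, .elem a, .elem b => a ≠ b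
  | .linLinEqual, .elem a, .elem b => a = b
  | .ordSing, .ordPair _ _ _, .pt => True
  | .unordSing, .unordPair _ _, .pt => True
  | .linSing, .elem _, .pt => True
  | .singSing, .pt, .pt => True
  | _, _, _ => False

namespace ClassificationGraph

/-- The vertices of `𝔣(C, n)`: every vertex of `C` is replaced by the orbit that its label
stands for. -/
abbrev DescVertex (C : ClassificationGraph) (n : ℕ) : Type :=
  {x : C.V × Point n // x.2.label = C.label x.1}

/-- The description map: the graph `𝔣(C, n)`. -/
def description (C : ClassificationGraph) (n : ℕ) : SimpleGraph (C.DescVertex n) :=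
  SimpleGraph.fromRel fun x y => ∃ ℓ : EdgeLabel, C.HasEdge ℓ x.1.1 y.1.1 ∧ ℓ.Rel x.1.2 y.1.2

/-- The action of `S_n` on the vertices of `𝔣(C, n)`. -/
def act (C : ClassificationGraph) {n : ℕ} (σ : Equiv.Perm (Fin n)) (x : C.DescVertex n) :
    C.DescVertex n :=
  ⟨(x.1.1, x.1.2.act σ), (Point.label_act σ x.1.2).trans x.2⟩

/-- `𝔣(C, n) ≅ G_n` as graphs with an action of `S_n`. -/
def Describes (C : ClassificationGraph) (G : FIGraph.{u}) (n : ℕ) : Prop :=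
  ∃ φ : C.description n ≃g G.graph n,
    ∀ (σ : Equiv.Perm (Fin n)) (x : C.DescVertex n), φ (C.act σ x) = G.map σ.toEmbedding (φ x)

end ClassificationGraph

namespace EdgeLabel

/-- The label that an edge from `u` to `v` with a given label receives when the points of the
orbit at `u` (if `r` is true) and those of the orbit at `v` (if `s` is true) are renamed by
`(a, b) ↦ (b, a)`. -/
def relabel (r s : Bool) : EdgeLabel → EdgeLabel
  | ordLoopFirst => if r then ordLoopSecond else ordLoopFirst
  | ordLoopSecond => if r then ordLoopFirst else ordLoopSecond
  | ordOrdFirst =>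
      match r, s with
      | false, false => ordOrdFirst
      | true, true => ordOrdSecond
      | _, _ => ordOrdFirstSecond
  | ordOrdSecond =>
      match r, s with
      | false, false => ordOrdSecond
      | true, true => ordOrdFirst
      | _, _ => ordOrdFirstSecond
  | ordOrdFirstSecond =>
      match r, s with
      | true, false => ordOrdSecond
      | false, true => ordOrdFirst
      | _, _ => ordOrdFirstSecond
  | ordOrdSame => if r = s then ordOrdSame else ordOrdSwap
  | ordOrdSwap => if r = s then ordOrdSwap else ordOrdSame
  | ordUnordFirst => if r || s then ordUnordSecond else ordUnordFirst
  | ordUnordSecond => if r || s then ordUnordFirst else ordUnordSecond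
  | ordLinFirst => if r || s then ordLinSecond else ordLinFirst
  | ordLinSecond => if r || s then ordLinFirst else ordLinSecond
  | ℓ => ℓ

/-- Whether the relabelled edge runs from `v` to `u` instead of from `u` to `v`; this matters only
when the new label is the directed one. -/
def flips (r s : Bool) : EdgeLabel → Bool
  | ordOrdFirst => r && !s
  | ordOrdSecond => !r && s
  | ordOrdFirstSecond => r && s
  | _ => false

end EdgeLabel

/-- Isomorphism of classification graphs: a bijection of the vertices preserving the vertex labels
and carrying the labelled edges to the labelled edges, up to the choice, at every vertex labelled
`v^{(1)}`, of which coordinate of the ordered pairs is called the first one. (When there are no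
such vertices, this is a label-preserving isomorphism of multigraphs.) -/
structure ClassificationGraph.Iso (C D : ClassificationGraph) where
  toEquiv : C.V ≃ D.V
  label_eq : ∀ v, D.label (toEquiv v) = C.label v
  /-- the vertices at which the ordered pairs are reversed -/
  rev : C.V → Bool
  rev_ordered : ∀ v, rev v = true → C.label v = .ordered
  hasEdge_iff : ∀ (ℓ : EdgeLabel) (u v : C.V), C.HasEdge ℓ u v ↔
    if ℓ.flips (rev u) (rev v) then
      D.HasEdge (ℓ.relabel (rev u) (rev v)) (toEquiv v) (toEquiv u)
    else
      D.HasEdge (ℓ.relabel (rev u) (rev v)) (toEquiv u) (toEquiv v)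

/-! Vertices. In large degree every vertex is an image of one of finitely many generators living in
a fixed degree `N`; taking their number minimal makes the families they generate disjoint
(`exists_generates_disjoint`). Let `H` be the stabilizer of the image `w` in degree `n` of a
generator. A transposition of two elements outside the image of `[N]` lies in `H`, so the set `A` of
elements that cannot be exchanged within `H` with a fixed outside element has size at most `N`. For
`n > 2N` the group `H` preserves `A` and contains every permutation fixing `A` pointwise. Hence the
orbit of `w` has at least `n.choose A.card` members, and quadratic growth leaves only `A.card ≤ 2`.
Then `H` is the stabilizer of an ordered pair, an unordered pair, an element or the invariant point
(`exists_point_of_subgroup`, `exists_isModel`), and one choice of point serves all large degrees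
(`eventually_isModel`).

Edges. The edge labels describe the orbits of `S_n` on pairs of points (`exists_perm_of_rel`), so
one adjacent pair makes all pairs with its label adjacent. Graph homomorphisms carry adjacency to
higher degrees, and there are finitely many labels and pairs of generators, so the pattern of edges
stabilizes (`eventually_describes`).

Uniqueness. An equivariant isomorphism matches orbits and stabilizers. For `n ≥ 5` a stabilizer
determines its point up to reversal (`Point.eq_or_eq_reverse_of_stabilizer_eq`), so the isomorphism
comes from a bijection of the vertices together with reversals. The labelled edges can be read off
from adjacency (`hasEdge_iff_iff_description_adj_iff`). -/

/-! ### Extending partial injections of finite sets. -/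

theorem exists_perm_apply_eq {ι α : Type*} [Finite α] {e g : ι → α}
    (he : Function.Injective e) (hg : Function.Injective g) :
    ∃ σ : Equiv.Perm α, ∀ i, σ (e i) = g i := by
  classical
  have := Fintype.ofFinite α
  let E : {x // x ∈ Set.range e} ≃ {x // x ∈ Set.range g} :=
    (Equiv.ofInjective e he).symm.trans (Equiv.ofInjective g hg)
  refine ⟨E.extendSubtype, fun i => ?_⟩
  rw [Equiv.extendSubtype_apply_of_mem E (e i) ⟨i, rfl⟩]
  have h : (Equiv.ofInjective e he).symm ⟨e i, ⟨i, rfl⟩⟩ = i :=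
    Equiv.ofInjective_symm_apply he i
  exact congrArg g h

theorem exists_embedding_apply_eq {ι : Type*} {m n : ℕ} (hmn : m ≤ n) {e : ι → Fin m}
    {g : ι → Fin n} (he : Function.Injective e) (hg : Function.Injective g) :
    ∃ f : Fin m ↪ Fin n, ∀ i, f (e i) = g i := by
  obtain ⟨σ, hσ⟩ := exists_perm_apply_eq
    ((Fin.castLEEmb hmn).injective.comp he) hg
  exact ⟨(Fin.castLEEmb hmn).trans σ.toEmbedding, hσ⟩

theorem exists_trans_eq {l m n : ℕ} (hmn : m ≤ n) (e : Fin l ↪ Fin m) (g : Fin l ↪ Fin n) :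
    ∃ f : Fin m ↪ Fin n, e.trans f = g := by
  obtain ⟨f, hf⟩ := exists_embedding_apply_eq hmn e.injective g.injective
  exact ⟨f, DFunLike.ext _ _ hf⟩

theorem exists_trans_perm_eq {m n : ℕ} (e g : Fin m ↪ Fin n) :
    ∃ σ : Equiv.Perm (Fin n), e.trans σ.toEmbedding = g := by
  obtain ⟨σ, hσ⟩ := exists_perm_apply_eq e.injective g.injective
  exact ⟨σ, DFunLike.ext _ _ hσ⟩

theorem exists_notMem_of_card_lt {n : ℕ} (s : Finset (Fin n)) (h : s.card < n) :
    ∃ d, d ∉ s := by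
  by_contra! hs
  rw [Finset.eq_univ_iff_forall.2 hs, Finset.card_fin] at h
  exact h.false

theorem exists_embedding_four {n : ℕ} {a b c d : Fin n} (hab : a ≠ b) (hac : a ≠ c) (had : a ≠ d)
    (hbc : b ≠ c) (hbd : b ≠ d) (hcd : c ≠ d) :
    ∃ f : Fin 4 ↪ Fin n, f 0 = a ∧ f 1 = b ∧ f 2 = c ∧ f 3 = d := by
  refine ⟨⟨![a, b, c, d], fun i j h => ?_⟩, rfl, rfl, rfl, rfl⟩
  fin_cases i <;> fin_cases j <;> simp_all

theorem exists_embedding_three {n : ℕ} (hn : 4 ≤ n) {a b c : Fin n} (hab : a ≠ b) (hac : a ≠ c)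
    (hbc : b ≠ c) : ∃ f : Fin 4 ↪ Fin n, f 0 = a ∧ f 1 = b ∧ f 2 = c := by
  obtain ⟨d, hd⟩ := exists_notMem_of_card_lt {a, b, c} (Finset.card_le_three.trans_lt hn)
  simp only [Finset.mem_insert, Finset.mem_singleton, not_or] at hd
  obtain ⟨f, h0, h1, h2, -⟩ := exists_embedding_four hab hac (Ne.symm hd.1) hbc (Ne.symm hd.2.1)
    (Ne.symm hd.2.2)
  exact ⟨f, h0, h1, h2⟩

theorem exists_embedding_two {n : ℕ} (hn : 4 ≤ n) {a b : Fin n} (hab : a ≠ b) :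
    ∃ f : Fin 4 ↪ Fin n, f 0 = a ∧ f 1 = b := by
  obtain ⟨c, hc⟩ := exists_notMem_of_card_lt {a, b} (Finset.card_le_two.trans_lt (by omega))
  simp only [Finset.mem_insert, Finset.mem_singleton, not_or] at hc
  obtain ⟨f, h0, h1, -⟩ := exists_embedding_three hn hab (Ne.symm hc.1) (Ne.symm hc.2)
  exact ⟨f, h0, h1⟩

theorem exists_embedding_one {n : ℕ} (hn : 4 ≤ n) (a : Fin n) :
    ∃ f : Fin 4 ↪ Fin n, f 0 = a := by
  obtain ⟨b, hb⟩ := exists_notMem_of_card_lt {a} (by simp; omega)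
  obtain ⟨f, h0, -⟩ := exists_embedding_two hn (Ne.symm (by simpa using hb) : a ≠ b)
  exact ⟨f, h0⟩

/-! ### Points, their supports and their stabilizers. -/

namespace Point

variable {l m n : ℕ}

/-- The functoriality of points with respect to injections. -/
def map (f : Fin m ↪ Fin n) : Point m → Point n
  | ordPair a b h => ordPair (f a) (f b) (f.injective.ne h)
  | unordPair s h => unordPair (s.map f) (by rw [Finset.card_map, h])
  | elem a => elem (f a)
  | pt => pt

/-- Renaming the ordered pairs by `(a, b) ↦ (b, a)`. -/
def reverse : Point n → Point n
  | ordPair a b h => ordPair b a h.symm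
  | x => x

/-- Renaming the ordered pairs by `(a, b) ↦ (b, a)` if `r` is true. -/
def rev (r : Bool) (x : Point n) : Point n := if r then x.reverse else x

/-- The elements of `[n]` that occur in a point. -/
def supp : Point n → Finset (Fin n)
  | ordPair a b _ => {a, b}
  | unordPair s _ => s
  | elem a => {a}
  | pt => ∅

theorem act_eq_map (σ : Equiv.Perm (Fin n)) (x : Point n) : x.act σ = x.map σ.toEmbedding := by
  cases x <;> rfl

theorem map_trans (f : Fin l ↪ Fin m) (g : Fin m ↪ Fin n) (x : Point l) :
    x.map (f.trans g) = (x.map f).map g := by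
  cases x <;> simp [map, Finset.map_map]

theorem map_refl (x : Point n) : x.map (Function.Embedding.refl _) = x := by
  cases x <;> simp [map]

theorem label_map (f : Fin m ↪ Fin n) (x : Point m) : (x.map f).label = x.label := by
  cases x <;> rfl

theorem map_injective (f : Fin m ↪ Fin n) : Function.Injective (map f) := by
  intro x y h
  cases x <;> cases y <;> simp_all [map]

theorem reverse_reverse (x : Point n) : x.reverse.reverse = x := by
  cases x <;> rfl

theorem rev_rev (r : Bool) (x : Point n) : (x.rev r).rev r = x := by
  cases r <;> simp [rev, reverse_reverse]

theorem label_rev (r : Bool) (x : Point n) : (x.rev r).label = x.label := by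
  cases r <;> cases x <;> rfl

theorem map_reverse (f : Fin m ↪ Fin n) (x : Point m) : x.reverse.map f = (x.map f).reverse := by
  cases x <;> rfl

theorem map_rev (f : Fin m ↪ Fin n) (r : Bool) (x : Point m) :
    (x.rev r).map f = (x.map f).rev r := by
  cases r <;> simp [rev, map_reverse]

theorem exists_map_eq_of_label_eq (hmn : m ≤ n) {x : Point m} {y : Point n}
    (h : x.label = y.label) : ∃ f : Fin m ↪ Fin n, x.map f = y := by
  have key {a b : Fin m} {c d : Fin n} (hab : a ≠ b) (hcd : c ≠ d) :
      ∃ f : Fin m ↪ Fin n, f a = c ∧ f b = d := by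
    obtain ⟨f, hf⟩ := exists_embedding_apply_eq hmn (e := ![a, b]) (g := ![c, d])
      (by intro i j; fin_cases i <;> fin_cases j <;> simp [hab, hab.symm])
      (by intro i j; fin_cases i <;> fin_cases j <;> simp [hcd, hcd.symm])
    exact ⟨f, hf 0, hf 1⟩
  cases x <;> cases y <;> simp only [label, reduceCtorEq] at h
  case ordPair.ordPair a b hab c d hcd =>
    obtain ⟨f, rfl, rfl⟩ := key hab hcd
    exact ⟨f, rfl⟩
  case unordPair.unordPair s hs t ht =>
    obtain ⟨a, b, hab, rfl⟩ := Finset.card_eq_two.1 hs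
    obtain ⟨c, d, hcd, rfl⟩ := Finset.card_eq_two.1 ht
    obtain ⟨f, rfl, rfl⟩ := key hab hcd
    exact ⟨f, by simp [map]⟩
  case elem.elem a c =>
    obtain ⟨f, hf⟩ := exists_embedding_apply_eq hmn (e := fun _ : Unit => a) (g := fun _ => c)
      (Function.injective_of_subsingleton _) (Function.injective_of_subsingleton _)
    exact ⟨f, by simp [map, hf ()]⟩
  case pt.pt => exact ⟨Fin.castLEEmb hmn, rfl⟩

theorem map_supp (f : Fin m ↪ Fin n) (x : Point m) : (x.map f).supp = x.supp.map f := by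
  cases x <;> simp [map, supp]

theorem exists_map_eq_of_supp_subset (f : Fin m ↪ Fin n) {x : Point n}
    (h : ∀ i ∈ x.supp, i ∈ Set.range f) : ∃ y : Point m, y.map f = x := by
  cases x with
  | ordPair a b hab =>
    obtain ⟨a, rfl⟩ := h a (by simp [supp])
    obtain ⟨b, rfl⟩ := h b (by simp [supp])
    exact ⟨ordPair a b (fun h => hab (h ▸ rfl)), rfl⟩
  | unordPair s hs =>
    obtain ⟨a, b, hab, rfl⟩ := Finset.card_eq_two.1 hs
    obtain ⟨a, rfl⟩ := h a (by simp [supp])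
    obtain ⟨b, rfl⟩ := h b (by simp [supp])
    exact ⟨unordPair {a, b} (Finset.card_pair (fun h => hab (h ▸ rfl))), by simp [map]⟩
  | elem a =>
    obtain ⟨a, rfl⟩ := h a (by simp [supp])
    exact ⟨elem a, rfl⟩
  | pt => exact ⟨pt, rfl⟩

theorem card_supp_le (x : Point n) : x.supp.card ≤ 2 := by
  cases x with
  | ordPair a b h => exact Finset.card_le_two
  | unordPair s h => exact h.le
  | elem a => simp [supp]
  | pt => simp [supp]

theorem act_eq_self_of_forall {σ : Equiv.Perm (Fin n)} {x : Point n}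
    (h : ∀ i ∈ x.supp, σ i = i) : x.act σ = x := by
  cases x with
  | ordPair a b hab => simp [act, h a (by simp [supp]), h b (by simp [supp])]
  | unordPair s hs =>
    simp only [act, unordPair.injEq]
    refine Finset.map_eq_of_subset fun i => ?_
    simp only [Finset.mem_map]
    rintro ⟨j, hj, rfl⟩
    have := h j hj
    simp_all
  | elem a => simp [act, h a (by simp [supp])]
  | pt => rfl

theorem supp_act (σ : Equiv.Perm (Fin n)) (x : Point n) :
    (x.act σ).supp = x.supp.map σ.toEmbedding := by
  rw [act_eq_map, map_supp]

theorem act_swap_eq_self_iff {c i : Fin n} {x : Point n} (hc : c ∉ x.supp) (hic : i ≠ c) :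
    x.act (Equiv.swap i c) = x ↔ i ∉ x.supp := by
  constructor
  · intro h hi
    apply hc
    have : (x.act (Equiv.swap i c)).supp = x.supp := by rw [h]
    rw [supp_act] at this
    rw [← this, Finset.mem_map]
    exact ⟨i, hi, by simp⟩
  · intro h
    refine act_eq_self_of_forall fun j hj => Equiv.swap_apply_of_ne_of_ne ?_ ?_ <;>
      rintro rfl <;> contradiction

/-- For `c` outside the support, the support consists of those `i` for which the transposition `(i
c)` moves the point. The two supports have at most four elements together, so `n ≥ 5` leaves a `c`
that works for both. -/
theorem supp_eq_of_stabilizer_eq (hn : 5 ≤ n) {x y : Point n}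
    (h : ∀ σ : Equiv.Perm (Fin n), x.act σ = x ↔ y.act σ = y) : x.supp = y.supp := by
  obtain ⟨c, hc⟩ := exists_notMem_of_card_lt (x.supp ∪ y.supp)
    (by have := Finset.card_union_le x.supp y.supp
        have := x.card_supp_le
        have := y.card_supp_le
        omega)
  simp only [Finset.mem_union, not_or] at hc
  ext i
  by_cases hi : i = c
  · subst hi; simp [hc]
  · rw [← not_iff_not, ← act_swap_eq_self_iff hc.1 hi, ← act_swap_eq_self_iff hc.2 hi, h]

/-- A point is determined, up to reversal, by its stabilizer. -/
theorem eq_or_eq_reverse_of_stabilizer_eq (hn : 5 ≤ n) {x y : Point n}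
    (h : ∀ σ : Equiv.Perm (Fin n), x.act σ = x ↔ y.act σ = y) : y = x ∨ y = x.reverse := by
  have hs := supp_eq_of_stabilizer_eq hn h
  -- Ordered and unordered pairs can share a support, but `(a b)` fixes the set `{a, b}` and moves
  -- the ordered pair.
  have key {a b : Fin n} (hab : a ≠ b) {s : Finset (Fin n)} (hs : s.card = 2) (e : {a, b} = s) :
      ¬ ((ordPair a b hab).act (Equiv.swap a b) = ordPair a b hab ↔
        (unordPair s hs).act (Equiv.swap a b) = unordPair s hs) := by
    subst e
    simp [act, hab.symm, Finset.pair_comm]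
  have card1 {a : Fin n} {s : Finset (Fin n)} (hs : s.card = 2) : {a} ≠ s := by
    rintro rfl; simp at hs
  cases x with
  | ordPair a b hab =>
    cases y with
    | ordPair c d hcd =>
      have h1 := Finset.ext_iff.1 hs
      simp only [supp, Finset.mem_insert, Finset.mem_singleton] at h1
      have h2 := (h1 a).1 (Or.inl rfl)
      have h3 := (h1 b).1 (Or.inr rfl)
      simp only [reverse, ordPair.injEq]
      clear h hs key card1 h1
      rcases h2 with rfl | rfl <;> rcases h3 with rfl | rfl <;> simp at *
    | unordPair s hs' => exact (key hab hs' hs (h _)).elim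
    | elem c => exact (card1 (Finset.card_pair hab) hs.symm).elim
    | pt => simp [supp] at hs
  | unordPair s hs' =>
    cases y with
    | ordPair c d hcd => exact (key hcd hs' hs.symm (h _).symm).elim
    | unordPair t ht => simp only [supp] at hs; subst hs; simp
    | elem c => exact (card1 hs' hs.symm).elim
    | pt => simp only [supp] at hs; subst hs; simp at hs'
  | elem a =>
    cases y with
    | ordPair c d hcd => exact (card1 (Finset.card_pair hcd) hs).elim
    | unordPair s hs' => exact (card1 hs' hs).elim
    | elem c => simp only [supp, Finset.singleton_inj] at hs; simp [hs]
    | pt => simp [supp] at hs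
  | pt =>
    cases y with
    | ordPair c d hcd => exact (Finset.insert_ne_empty _ _ hs.symm).elim
    | unordPair s hs' => simp only [supp] at hs; subst hs; simp at hs'
    | elem c => simp [supp] at hs
    | pt => simp

theorem exists_label_eq (hn : 2 ≤ n) (k : VertexLabel) : ∃ x : Point n, x.label = k := by
  have h : (⟨0, by omega⟩ : Fin n) ≠ ⟨1, by omega⟩ := by simp
  cases k
  · exact ⟨ordPair _ _ h, rfl⟩
  · exact ⟨unordPair _ (Finset.card_pair h), rfl⟩
  · exact ⟨elem ⟨0, by omega⟩, rfl⟩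
  · exact ⟨pt, rfl⟩

end Point

/-! ### Edge labels as orbits of pairs of points. -/

namespace EdgeLabel

variable {m n : ℕ}

/-- The first point of a standard pair of points joined by an edge with a given label. -/
def src : EdgeLabel → Point 4
  | ordLoopDisjoint | ordLoopFirst | ordLoopSecond | ordLoopChain | ordLoopSwap
  | ordOrdDisjoint | ordOrdFirstSecond | ordOrdFirst | ordOrdSecond | ordOrdSame | ordOrdSwap
  | ordUnordDisjoint | ordUnordFirst | ordUnordSecond | ordUnordBoth
  | ordLinDisjoint | ordLinFirst | ordLinSecond | ordSing => .ordPair 0 1 (by decide)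
  | unordLoopDisjoint | unordLoopShare
  | unordUnordDisjoint | unordUnordShare | unordUnordSame
  | unordLinDisjoint | unordLinShare | unordSing => .unordPair {0, 1} (by decide)
  | linLoop | linLinDistinct | linLinEqual | linSing => .elem 0
  | singSing => .pt

/-- The second point of a standard pair of points joined by an edge with a given label. -/
def tgt : EdgeLabel → Point 4
  | ordLoopDisjoint | ordOrdDisjoint => .ordPair 2 3 (by decide)
  | ordLoopFirst | ordOrdFirst => .ordPair 0 2 (by decide)
  | ordLoopSecond | ordOrdSecond => .ordPair 2 1 (by decide)
  | ordLoopChain => .ordPair 1 2 (by decide)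
  | ordLoopSwap | ordOrdSwap => .ordPair 1 0 (by decide)
  | ordOrdFirstSecond => .ordPair 2 0 (by decide)
  | ordOrdSame => .ordPair 0 1 (by decide)
  | ordUnordDisjoint | unordLoopDisjoint | unordUnordDisjoint => .unordPair {2, 3} (by decide)
  | ordUnordFirst | unordLoopShare | unordUnordShare => .unordPair {0, 2} (by decide)
  | ordUnordSecond => .unordPair {1, 2} (by decide)
  | ordUnordBoth | unordUnordSame => .unordPair {0, 1} (by decide)
  | ordLinDisjoint | unordLinDisjoint => .elem 2
  | ordLinFirst | unordLinShare | linLinEqual => .elem 0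
  | ordLinSecond | linLoop | linLinDistinct => .elem 1
  | ordSing | unordSing | linSing | singSing => .pt

theorem label_eq_of_rel {ℓ : EdgeLabel} {x y : Point n} (h : ℓ.Rel x y) :
    x.label = ℓ.src.label ∧ y.label = ℓ.tgt.label := by
  cases ℓ <;> cases x <;> cases y <;> first | exact ⟨rfl, rfl⟩ | exact h.elim

theorem ends_eq_of_rel {ℓ : EdgeLabel} {x y : Point n} (h : ℓ.Rel x y) :
    ℓ.ends = s(x.label, y.label) := by
  rw [(label_eq_of_rel h).1, (label_eq_of_rel h).2]
  cases ℓ <;> rfl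

theorem rel_map_iff (ℓ : EdgeLabel) (f : Fin m ↪ Fin n) (x y : Point m) :
    ℓ.Rel (x.map f) (y.map f) ↔ ℓ.Rel x y := by
  cases ℓ <;> cases x <;> cases y <;> first
    | exact Iff.rfl
    | simp only [Rel, Point.map, ← Finset.map_inter, Finset.card_map, Finset.mem_map',
        f.injective.ne_iff, f.injective.eq_iff]

theorem rel_src_tgt (ℓ : EdgeLabel) : ℓ.Rel ℓ.src ℓ.tgt := by
  cases ℓ <;> simp [Rel, src, tgt]

theorem exists_eq_pair_of_mem {s : Finset (Fin n)} (hs : s.card = 2) {a : Fin n} (ha : a ∈ s) :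
    ∃ b, a ≠ b ∧ s = {a, b} := by
  obtain ⟨b, c, hbc, rfl⟩ := Finset.card_eq_two.1 hs
  rcases Finset.mem_insert.1 ha with rfl | hac
  · exact ⟨c, hbc, rfl⟩
  · rw [Finset.mem_singleton] at hac
    subst hac
    exact ⟨b, hbc.symm, Finset.pair_comm _ _⟩

theorem exists_pair_of_card_inter {s t : Finset (Fin n)} (hs : s.card = 2) (ht : t.card = 2)
    (h : (s ∩ t).card = 1) : ∃ a b c, a ≠ b ∧ a ≠ c ∧ b ≠ c ∧ s = {a, b} ∧ t = {a, c} := by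
  obtain ⟨a, ha⟩ := Finset.card_eq_one.1 h
  have has : a ∈ s ∩ t := by simp [ha]
  rw [Finset.mem_inter] at has
  obtain ⟨b, hab, rfl⟩ := exists_eq_pair_of_mem hs has.1
  obtain ⟨c, hac, rfl⟩ := exists_eq_pair_of_mem ht has.2
  refine ⟨a, b, c, hab, hac, ?_, rfl, rfl⟩
  rintro rfl
  simp [Finset.card_pair hab] at h

theorem eq_of_card_inter {s t : Finset (Fin n)} (hs : s.card = 2) (ht : t.card = 2)
    (h : (s ∩ t).card = 2) : s = t := by
  rw [← Finset.eq_of_subset_of_card_le Finset.inter_subset_left (hs.trans h.symm).le]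
  exact Finset.eq_of_subset_of_card_le Finset.inter_subset_right (ht.trans h.symm).le

/-- All pairs of points joined by edges with a given label are images of the standard one. -/
theorem exists_map_src_tgt (hn : 4 ≤ n) {ℓ : EdgeLabel} {x y : Point n} (h : ℓ.Rel x y) :
    ∃ f : Fin 4 ↪ Fin n, ℓ.src.map f = x ∧ ℓ.tgt.map f = y := by
  have disj {a b c d : Fin n} (hab : a ≠ b) (hcd : c ≠ d) (hac : a ≠ c) (had : a ≠ d)
      (hbc : b ≠ c) (hbd : b ≠ d) := exists_embedding_four hab hac had hbc hbd hcd
  cases ℓ <;> cases x <;> cases y <;> try exact h.elim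
  case ordLoopDisjoint a b hab c d hcd | ordOrdDisjoint a b hab c d hcd =>
    obtain ⟨f, rfl, rfl, rfl, rfl⟩ := disj hab hcd h.1 h.2.1 h.2.2.1 h.2.2.2
    exact ⟨f, rfl, rfl⟩
  case ordLoopFirst a b hab c d hcd | ordOrdFirst a b hab c d hcd =>
    obtain ⟨rfl, h⟩ := h
    obtain ⟨f, rfl, rfl, rfl⟩ := exists_embedding_three hn hab hcd h
    exact ⟨f, rfl, rfl⟩
  case ordLoopSecond a b hab c d hcd | ordOrdSecond a b hab c d hcd =>
    obtain ⟨h, rfl⟩ := h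
    obtain ⟨f, rfl, rfl, rfl⟩ := exists_embedding_three hn hab h hcd.symm
    exact ⟨f, rfl, rfl⟩
  case ordLoopChain a b hab c d hcd =>
    obtain ⟨rfl, h⟩ := h
    obtain ⟨f, rfl, rfl, rfl⟩ := exists_embedding_three hn hab h hcd
    exact ⟨f, rfl, rfl⟩
  case ordOrdFirstSecond a b hab c d hcd =>
    obtain ⟨rfl, h⟩ := h
    obtain ⟨f, rfl, rfl, rfl⟩ := exists_embedding_three hn hab hcd.symm h
    exact ⟨f, rfl, rfl⟩
  case ordLoopSwap a b hab c d hcd | ordOrdSame a b hab c d hcd | ordOrdSwap a b hab c d hcd =>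
    obtain ⟨rfl, rfl⟩ := h
    obtain ⟨f, rfl, rfl⟩ := exists_embedding_two hn hab
    exact ⟨f, rfl, rfl⟩
  case unordLoopDisjoint s hs t ht | unordUnordDisjoint s hs t ht =>
    obtain ⟨a, b, hab, rfl⟩ := Finset.card_eq_two.1 hs
    obtain ⟨c, d, hcd, rfl⟩ := Finset.card_eq_two.1 ht
    have h := Finset.disjoint_left.1
      (Finset.disjoint_iff_inter_eq_empty.2 (Finset.card_eq_zero.1 h))
    simp at h
    obtain ⟨f, rfl, rfl, rfl, rfl⟩ := disj hab hcd h.1.1 h.1.2 h.2.1 h.2.2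
    exact ⟨f, by simp [Point.map, src], by simp [Point.map, tgt]⟩
  case unordLoopShare s hs t ht | unordUnordShare s hs t ht =>
    obtain ⟨a, b, c, hab, hac, hbc, rfl, rfl⟩ := exists_pair_of_card_inter hs ht h
    obtain ⟨f, rfl, rfl, rfl⟩ := exists_embedding_three hn hab hac hbc
    exact ⟨f, by simp [Point.map, src], by simp [Point.map, tgt]⟩
  case unordUnordSame s hs t ht =>
    obtain rfl := eq_of_card_inter hs ht h
    obtain ⟨a, b, hab, rfl⟩ := Finset.card_eq_two.1 hs
    obtain ⟨f, rfl, rfl⟩ := exists_embedding_two hn hab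
    exact ⟨f, by simp [Point.map, src], by simp [Point.map, tgt]⟩
  case ordUnordDisjoint a b hab s hs =>
    obtain ⟨c, d, hcd, rfl⟩ := Finset.card_eq_two.1 hs
    simp [Rel] at h
    obtain ⟨f, rfl, rfl, rfl, rfl⟩ := disj hab hcd h.1.1 h.1.2 h.2.1 h.2.2
    exact ⟨f, by simp [Point.map, src], by simp [Point.map, tgt]⟩
  case ordUnordFirst a b hab s hs =>
    obtain ⟨h1, h2⟩ := h
    obtain ⟨c, hac, rfl⟩ := exists_eq_pair_of_mem hs h1
    simp at h2
    obtain ⟨f, rfl, rfl, rfl⟩ := exists_embedding_three hn hab hac h2.2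
    exact ⟨f, by simp [Point.map, src], by simp [Point.map, tgt]⟩
  case ordUnordSecond a b hab s hs =>
    obtain ⟨h1, h2⟩ := h
    obtain ⟨c, hbc, rfl⟩ := exists_eq_pair_of_mem hs h2
    simp at h1
    obtain ⟨f, rfl, rfl, rfl⟩ := exists_embedding_three hn hab h1.2 hbc
    exact ⟨f, by simp [Point.map, src], by simp [Point.map, tgt]⟩
  case ordUnordBoth a b hab s hs =>
    obtain ⟨h1, h2⟩ := h
    obtain ⟨c, hac, rfl⟩ := exists_eq_pair_of_mem hs h1
    simp [hab.symm] at h2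
    subst h2
    obtain ⟨f, rfl, rfl⟩ := exists_embedding_two hn hab
    exact ⟨f, by simp [Point.map, src], by simp [Point.map, tgt]⟩
  case ordLinDisjoint a b hab c =>
    obtain ⟨f, rfl, rfl, rfl⟩ := exists_embedding_three hn hab h.1 h.2
    exact ⟨f, rfl, rfl⟩
  case ordLinFirst a b hab c | ordLinSecond a b hab c =>
    obtain rfl := h
    obtain ⟨f, rfl, rfl⟩ := exists_embedding_two hn hab
    exact ⟨f, rfl, rfl⟩
  case unordLinDisjoint s hs c =>
    obtain ⟨a, b, hab, rfl⟩ := Finset.card_eq_two.1 hs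
    simp [Rel] at h
    obtain ⟨f, rfl, rfl, rfl⟩ := exists_embedding_three hn hab (Ne.symm h.1) (Ne.symm h.2)
    exact ⟨f, by simp [Point.map, src], by simp [Point.map, tgt]⟩
  case unordLinShare s hs c =>
    obtain ⟨b, hcb, rfl⟩ := exists_eq_pair_of_mem hs h
    obtain ⟨f, rfl, rfl⟩ := exists_embedding_two hn hcb
    exact ⟨f, by simp [Point.map, src], by simp [Point.map, tgt]⟩
  case linLoop a b | linLinDistinct a b =>
    obtain ⟨f, rfl, rfl⟩ := exists_embedding_two hn h
    exact ⟨f, rfl, rfl⟩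
  case linLinEqual a b =>
    obtain rfl := h
    obtain ⟨f, rfl⟩ := exists_embedding_one hn a
    exact ⟨f, rfl, rfl⟩
  case ordSing a b hab =>
    obtain ⟨f, rfl, rfl⟩ := exists_embedding_two hn hab
    exact ⟨f, rfl, rfl⟩
  case unordSing s hs =>
    obtain ⟨a, b, hab, rfl⟩ := Finset.card_eq_two.1 hs
    obtain ⟨f, rfl, rfl⟩ := exists_embedding_two hn hab
    exact ⟨f, by simp [Point.map, src], rfl⟩
  case linSing a =>
    obtain ⟨f, rfl⟩ := exists_embedding_one hn a
    exact ⟨f, rfl, rfl⟩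
  case singSing => exact ⟨Fin.castLEEmb hn, rfl, rfl⟩

/-- A finite check that the relations are mutually exclusive. Loop status has to be fixed because
some loop labels, such as `ordLoopFirst` and `ordOrdFirst`, share their relation with an edge label.
-/
theorem eq_of_rel_src_tgt {ℓ ℓ' : EdgeLabel} (hl : ℓ.IsLoop ↔ ℓ'.IsLoop)
    (h : ℓ'.Rel ℓ.src ℓ.tgt) : ℓ' = ℓ := by
  cases ℓ <;> cases ℓ' <;> first
    | rfl
    | exact h.elim
    | (simp [IsLoop] at hl; done)
    | simp [Rel, src, tgt] at h

/-- A finite check; for the directed label it is vacuous, since its reversed standard pair lies in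
no relation of a non-loop. -/
theorem eq_and_ne_of_rel_tgt_src {ℓ ℓ' : EdgeLabel} (hl : ℓ.IsLoop ↔ ℓ'.IsLoop)
    (h : ℓ'.Rel ℓ.tgt ℓ.src) : ℓ' = ℓ ∧ ℓ ≠ ordOrdFirstSecond := by
  cases ℓ <;> cases ℓ' <;> first
    | exact h.elim
    | (simp [IsLoop] at hl; done)
    | (simp [Rel, src, tgt] at h; done)
    | simp

/-- The pairs of points joined by an edge, in both orders unless the label is directed. -/
def SymmRel (ℓ : EdgeLabel) (x y : Point n) : Prop :=
  ℓ.Rel x y ∨ ℓ ≠ ordOrdFirstSecond ∧ ℓ.Rel y x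

theorem SymmRel.symm {ℓ : EdgeLabel} (hℓ : ℓ ≠ ordOrdFirstSecond) {x y : Point n}
    (h : ℓ.SymmRel x y) : ℓ.SymmRel y x := by
  rcases h with h | h
  · exact .inr ⟨hℓ, h⟩
  · exact .inl h.2

theorem symmRel_map_iff (ℓ : EdgeLabel) (f : Fin m ↪ Fin n) (x y : Point m) :
    ℓ.SymmRel (x.map f) (y.map f) ↔ ℓ.SymmRel x y := by
  simp only [SymmRel, rel_map_iff]

theorem ne_of_symmRel {ℓ : EdgeLabel} (hℓ : ℓ.IsLoop) {x y : Point n} (h : ℓ.SymmRel x y) :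
    x ≠ y := by
  rintro rfl
  have h : ℓ.Rel x x := h.elim id And.right
  cases ℓ <;> cases x <;> first
    | exact h.elim
    | exact hℓ.elim
    | (simp [Rel] at h; done)
    | (simp only [Rel, Finset.inter_self] at h; omega)

theorem SymmRel.eq_of_rel (hn : 4 ≤ n) {ℓ ℓ' : EdgeLabel} (hl : ℓ.IsLoop ↔ ℓ'.IsLoop)
    {x y : Point n} (h : ℓ.SymmRel x y) (h' : ℓ'.Rel x y) : ℓ' = ℓ := by
  rcases h with h | ⟨-, h⟩ <;> obtain ⟨f, rfl, rfl⟩ := exists_map_src_tgt hn h <;>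
    rw [rel_map_iff] at h'
  · exact eq_of_rel_src_tgt hl h'
  · exact (eq_and_ne_of_rel_tgt_src hl h').1

theorem SymmRel.eq_and_ne_of_rel (hn : 4 ≤ n) {ℓ ℓ' : EdgeLabel} (hl : ℓ.IsLoop ↔ ℓ'.IsLoop)
    {x y : Point n} (h : ℓ.SymmRel x y) (h' : ℓ'.Rel y x) : ℓ' = ℓ ∧ ℓ ≠ ordOrdFirstSecond := by
  rcases h with h | ⟨hℓ, h⟩ <;> obtain ⟨f, rfl, rfl⟩ := exists_map_src_tgt hn h <;>
    rw [rel_map_iff] at h'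
  · exact eq_and_ne_of_rel_tgt_src hl h'
  · exact ⟨eq_of_rel_src_tgt hl h', hℓ⟩

/-- Two points of different orbits are in one of the relations given by the labels of edges. -/
theorem exists_rel (x y : Point n) : ∃ ℓ : EdgeLabel, ¬ ℓ.IsLoop ∧ (ℓ.Rel x y ∨ ℓ.Rel y x) := by
  have ou (a b : Fin n) (hab : a ≠ b) (s : Finset (Fin n)) (hs : s.card = 2) :
      ∃ ℓ : EdgeLabel, ¬ ℓ.IsLoop ∧ ℓ.Rel (.ordPair a b hab) (.unordPair s hs) := by
    by_cases h1 : a ∈ s <;> by_cases h2 : b ∈ s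
    · exact ⟨ordUnordBoth, id, h1, h2⟩
    · exact ⟨ordUnordFirst, id, h1, h2⟩
    · exact ⟨ordUnordSecond, id, h1, h2⟩
    · exact ⟨ordUnordDisjoint, id, h1, h2⟩
  have ol (a b : Fin n) (hab : a ≠ b) (c : Fin n) :
      ∃ ℓ : EdgeLabel, ¬ ℓ.IsLoop ∧ ℓ.Rel (.ordPair a b hab) (.elem c) := by
    by_cases h1 : a = c
    · exact ⟨ordLinFirst, id, h1⟩
    by_cases h2 : b = c
    · exact ⟨ordLinSecond, id, h2⟩
    · exact ⟨ordLinDisjoint, id, h1, h2⟩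
  have ul (s : Finset (Fin n)) (hs : s.card = 2) (c : Fin n) :
      ∃ ℓ : EdgeLabel, ¬ ℓ.IsLoop ∧ ℓ.Rel (.unordPair s hs) (.elem c) := by
    by_cases h1 : c ∈ s
    · exact ⟨unordLinShare, id, h1⟩
    · exact ⟨unordLinDisjoint, id, h1⟩
  have left {x y : Point n} (h : ∃ ℓ : EdgeLabel, ¬ ℓ.IsLoop ∧ ℓ.Rel x y) :
      ∃ ℓ : EdgeLabel, ¬ ℓ.IsLoop ∧ (ℓ.Rel x y ∨ ℓ.Rel y x) :=
    h.imp fun _ h => h.imp_right Or.inl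
  have right {x y : Point n} (h : ∃ ℓ : EdgeLabel, ¬ ℓ.IsLoop ∧ ℓ.Rel y x) :
      ∃ ℓ : EdgeLabel, ¬ ℓ.IsLoop ∧ (ℓ.Rel x y ∨ ℓ.Rel y x) :=
    h.imp fun _ h => h.imp_right Or.inr
  cases x with
  | ordPair a b hab =>
    cases y with
    | ordPair c d hcd =>
      by_cases h1 : a = c
      · by_cases h2 : b = d
        · exact ⟨ordOrdSame, id, .inl ⟨h1, h2⟩⟩
        · exact ⟨ordOrdFirst, id, .inl ⟨h1, h2⟩⟩
      by_cases h2 : b = d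
      · exact ⟨ordOrdSecond, id, .inl ⟨h1, h2⟩⟩
      by_cases h3 : a = d
      · by_cases h4 : b = c
        · exact ⟨ordOrdSwap, id, .inl ⟨h3, h4⟩⟩
        · exact ⟨ordOrdFirstSecond, id, .inl ⟨h3, h4⟩⟩
      -- In the case `b = c` the directed relation holds from the second point to the first.
      by_cases h4 : b = c
      · exact ⟨ordOrdFirstSecond, id, .inr ⟨h4.symm, Ne.symm h3⟩⟩
      · exact ⟨ordOrdDisjoint, id, .inl ⟨h1, h3, h4, h2⟩⟩
    | unordPair s hs => exact left (ou a b hab s hs)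
    | elem c => exact left (ol a b hab c)
    | pt => exact ⟨ordSing, id, .inl trivial⟩
  | unordPair s hs =>
    cases y with
    | ordPair c d hcd => exact right (ou c d hcd s hs)
    | unordPair t ht =>
      have : (s ∩ t).card ≤ 2 := (Finset.card_le_card Finset.inter_subset_left).trans hs.le
      interval_cases h : (s ∩ t).card
      · exact ⟨unordUnordDisjoint, id, .inl h⟩
      · exact ⟨unordUnordShare, id, .inl h⟩
      · exact ⟨unordUnordSame, id, .inl h⟩
    | elem c => exact left (ul s hs c)
    | pt => exact ⟨unordSing, id, .inl trivial⟩
  | elem a =>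
    cases y with
    | ordPair c d hcd => exact right (ol c d hcd a)
    | unordPair t ht => exact right (ul t ht a)
    | elem c =>
      by_cases h : a = c
      · exact ⟨linLinEqual, id, .inl h⟩
      · exact ⟨linLinDistinct, id, .inl h⟩
    | pt => exact ⟨linSing, id, .inl trivial⟩
  | pt =>
    cases y with
    | ordPair c d hcd => exact ⟨ordSing, id, .inr trivial⟩
    | unordPair t ht => exact ⟨unordSing, id, .inr trivial⟩
    | elem c => exact ⟨linSing, id, .inr trivial⟩
    | pt => exact ⟨singSing, id, .inl trivial⟩

/-- Two points of one orbit are in one of the relations given by the labels of loops. -/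
theorem exists_loop_rel {x y : Point n} (hl : x.label = y.label) (hxy : x ≠ y) :
    ∃ ℓ : EdgeLabel, ℓ.IsLoop ∧ (ℓ.Rel x y ∨ ℓ.Rel y x) := by
  cases x <;> cases y <;> simp only [Point.label, reduceCtorEq] at hl
  case ordPair.ordPair a b hab c d hcd =>
    by_cases h1 : a = c
    · exact ⟨ordLoopFirst, trivial, .inl ⟨h1, fun h2 => hxy (by subst h1 h2; rfl)⟩⟩
    by_cases h2 : b = d
    · exact ⟨ordLoopSecond, trivial, .inl ⟨h1, h2⟩⟩
    by_cases h3 : a = d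
    · by_cases h4 : b = c
      · exact ⟨ordLoopSwap, trivial, .inl ⟨h3, h4⟩⟩
      · exact ⟨ordLoopChain, trivial, .inr ⟨h3.symm, Ne.symm h4⟩⟩
    by_cases h4 : b = c
    · exact ⟨ordLoopChain, trivial, .inl ⟨h4, h3⟩⟩
    · exact ⟨ordLoopDisjoint, trivial, .inl ⟨h1, h3, h4, h2⟩⟩
  case unordPair.unordPair s hs t ht =>
    have : (s ∩ t).card ≤ 2 := (Finset.card_le_card Finset.inter_subset_left).trans hs.le
    interval_cases h : (s ∩ t).card
    · exact ⟨unordLoopDisjoint, trivial, .inl h⟩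
    · exact ⟨unordLoopShare, trivial, .inl h⟩
    · refine (hxy ?_).elim
      obtain rfl := eq_of_card_inter hs ht h
      rfl
  case elem.elem a c => exact ⟨linLoop, trivial, .inl fun h => hxy (h ▸ rfl)⟩
  case pt.pt => exact (hxy rfl).elim

theorem ends_relabel (r s : Bool) (ℓ : EdgeLabel) : (ℓ.relabel r s).ends = ℓ.ends := by
  cases r <;> cases s <;> cases ℓ <;> rfl

theorem isLoop_relabel (r s : Bool) (ℓ : EdgeLabel) : (ℓ.relabel r s).IsLoop ↔ ℓ.IsLoop := by
  cases r <;> cases s <;> cases ℓ <;> exact Iff.rfl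

/-- The whole table of relabellings is verified here, on standard pairs only; injections transport
it to all pairs. Only ordered pairs may be reversed, and a loop reverses both of its ends together.
-/
theorem relabel_src_tgt {ℓ : EdgeLabel} {r s : Bool} (hr : r = true → ℓ.src.label = .ordered)
    (hs : s = true → ℓ.tgt.label = .ordered) (hrs : ℓ.IsLoop → r = s) :
    if ℓ.flips r s then (ℓ.relabel r s).SymmRel (ℓ.tgt.rev s) (ℓ.src.rev r)
    else (ℓ.relabel r s).SymmRel (ℓ.src.rev r) (ℓ.tgt.rev s) := by
  cases r <;> cases s <;> cases ℓ <;>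
    simp [src, tgt, Point.label, IsLoop, relabel, flips, SymmRel, Rel, Point.rev,
      Point.reverse] at hr hs hrs ⊢

/-- An undirected edge can be read from either end, and the table must give the same result both
ways; a resulting directed edge has its `flips` value negated because its ends are named in the
other order. -/
theorem relabel_comm (r s : Bool) (ℓ : EdgeLabel) (hℓ : ℓ ≠ ordOrdFirstSecond)
    (hrs : ℓ.IsLoop → r = s) : ℓ.relabel s r = ℓ.relabel r s ∧
      (ℓ.relabel r s = ordOrdFirstSecond → ℓ.flips s r = !ℓ.flips r s) := by
  cases r <;> cases s <;> cases ℓ <;> simp [relabel, flips, IsLoop] at hℓ hrs ⊢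

/-- The meaning of the relabelling of the edges. -/
theorem SymmRel.relabel (hn : 4 ≤ n) {ℓ : EdgeLabel} {x y : Point n} (h : ℓ.SymmRel x y)
    {r s : Bool} (hr : r = true → x.label = .ordered) (hs : s = true → y.label = .ordered)
    (hrs : ℓ.IsLoop → r = s) :
    if ℓ.flips r s then (ℓ.relabel r s).SymmRel (y.rev s) (x.rev r)
    else (ℓ.relabel r s).SymmRel (x.rev r) (y.rev s) := by
  rcases h with h | ⟨hℓ, h⟩ <;> obtain ⟨f, rfl, rfl⟩ := exists_map_src_tgt hn h <;>
    simp only [Point.label_map] at hr hs <;>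
    simp only [← Point.map_rev, symmRel_map_iff]
  · exact relabel_src_tgt hr hs hrs
  -- Here the standard pair is `(y, x)`, so the roles of `r` and `s` are exchanged and then restored
  -- by `relabel_comm`.
  · have key := relabel_src_tgt hs hr fun h => (hrs h).symm
    obtain ⟨h1, h2⟩ := relabel_comm r s ℓ hℓ hrs
    rw [h1] at key
    by_cases hd : ℓ.relabel r s = ordOrdFirstSecond
    · rw [h2 hd] at key
      cases hf : ℓ.flips r s <;> simpa [hf] using key
    · have : (ℓ.relabel r s).SymmRel (ℓ.tgt.rev r) (ℓ.src.rev s) := by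
        split_ifs at key
        · exact key
        · exact key.symm hd
      split_ifs
      · exact this.symm hd
      · exact this

/-- There are points joined by an edge with a given label in any orbits of the right kinds. -/
theorem exists_symmRel (hn : 4 ≤ n) {ℓ : EdgeLabel} {j k : VertexLabel} (h : ℓ.ends = s(j, k)) :
    ∃ x y : Point n, x.label = j ∧ y.label = k ∧ ℓ.SymmRel x y := by
  have hrel := (ℓ.rel_map_iff (Fin.castLEEmb hn) _ _).2 ℓ.rel_src_tgt
  have h' := ends_eq_of_rel hrel
  rw [h, Sym2.eq_iff] at h'
  by_cases hℓ : ℓ = ordOrdFirstSecond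
  · refine ⟨_, _, ?_, ?_, .inl hrel⟩ <;> subst hℓ <;>
      rcases h' with ⟨rfl, rfl⟩ | ⟨rfl, rfl⟩ <;> rfl
  · rcases h' with ⟨rfl, rfl⟩ | ⟨rfl, rfl⟩
    · exact ⟨_, _, rfl, rfl, .inl hrel⟩
    · exact ⟨_, _, rfl, rfl, .inr ⟨hℓ, hrel⟩⟩

end EdgeLabel

/-! ### Recovering a classification graph from its description. -/

namespace ClassificationGraph

variable {C D : ClassificationGraph} {n : ℕ}

theorem description_adj_iff {X Y : C.DescVertex n} : (C.description n).Adj X Y ↔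
    X ≠ Y ∧ ((∃ ℓ : EdgeLabel, C.HasEdge ℓ X.1.1 Y.1.1 ∧ ℓ.Rel X.1.2 Y.1.2) ∨
      ∃ ℓ : EdgeLabel, C.HasEdge ℓ Y.1.1 X.1.1 ∧ ℓ.Rel Y.1.2 X.1.2) := by
  simp only [description, SimpleGraph.fromRel_adj]

/-- The edges of a classification graph can be read off its description. -/
theorem description_adj_iff_hasEdge (hn : 4 ≤ n) {ℓ : EdgeLabel} {X Y : C.DescVertex n}
    (hℓ : ℓ.IsLoop ↔ X.1.1 = Y.1.1) (h : ℓ.SymmRel X.1.2 Y.1.2) :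
    (C.description n).Adj X Y ↔ C.HasEdge ℓ X.1.1 Y.1.1 := by
  rw [description_adj_iff]
  constructor
  · rintro ⟨-, ⟨ℓ', h1, h2⟩ | ⟨ℓ', h1, h2⟩⟩
    · obtain rfl := h.eq_of_rel hn (hℓ.trans (C.isLoop_iff h1).symm) h2
      exact h1
    · obtain ⟨rfl, hd⟩ := h.eq_and_ne_of_rel hn
        (hℓ.trans (eq_comm.trans (C.isLoop_iff h1).symm)) h2
      exact C.symm hd h1
  · intro he
    refine ⟨?_, ?_⟩
    · rintro rfl
      exact EdgeLabel.ne_of_symmRel (hℓ.2 rfl) h rfl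
    · rcases h with h | ⟨hd, h⟩
      · exact .inl ⟨ℓ, he, h⟩
      · exact .inr ⟨ℓ, C.symm hd he, h⟩

theorem exists_rel_of_ne {X Y : C.DescVertex n} (h : X ≠ Y) :
    ∃ ℓ : EdgeLabel, (ℓ.IsLoop ↔ X.1.1 = Y.1.1) ∧
      (ℓ.Rel X.1.2 Y.1.2 ∨ ℓ.Rel Y.1.2 X.1.2) := by
  obtain ⟨⟨u, x⟩, hx⟩ := X
  obtain ⟨⟨v, y⟩, hy⟩ := Y
  by_cases huv : u = v
  · subst huv
    obtain ⟨ℓ, hℓ, h⟩ := EdgeLabel.exists_loop_rel (hx.trans hy.symm)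
      (fun hxy : x = y => h (by subst hxy; rfl))
    exact ⟨ℓ, iff_of_true hℓ rfl, h⟩
  · obtain ⟨ℓ, hℓ, h⟩ := EdgeLabel.exists_rel x y
    exact ⟨ℓ, iff_of_false hℓ huv, h⟩

/-- The map of the vertices of the descriptions given by a map of classification graphs and a set
of vertices at which the ordered pairs are reversed. -/
def descMap (e : C.V → D.V) (he : ∀ v, D.label (e v) = C.label v) (r : C.V → Bool)
    (X : C.DescVertex n) : D.DescVertex n :=
  ⟨(e X.1.1, X.1.2.rev (r X.1.1)), by rw [Point.label_rev, he, X.2]⟩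

/-- Any two distinct points of a description are related, in some order, by a label of the right
loop status, and adjacency is the presence of that edge. Since `descMap` changes the label exactly
as `relabel` and `flips` prescribe, comparing edges and comparing adjacency are the same task. -/
theorem hasEdge_iff_iff_description_adj_iff (hn : 4 ≤ n) {e : C.V → D.V}
    (he : ∀ v, D.label (e v) = C.label v) (he' : Function.Injective e) {r : C.V → Bool}
    (hr : ∀ v, r v = true → C.label v = .ordered) :
    (∀ (ℓ : EdgeLabel) (u v : C.V), C.HasEdge ℓ u v ↔
      if ℓ.flips (r u) (r v) then D.HasEdge (ℓ.relabel (r u) (r v)) (e v) (e u)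
      else D.HasEdge (ℓ.relabel (r u) (r v)) (e u) (e v)) ↔
    ∀ X Y : C.DescVertex n, (C.description n).Adj X Y ↔
      (D.description n).Adj (descMap e he r X) (descMap e he r Y) := by
  have key {ℓ : EdgeLabel} {X Y : C.DescVertex n} (hℓ : ℓ.IsLoop ↔ X.1.1 = Y.1.1)
      (h : ℓ.SymmRel X.1.2 Y.1.2) :
      (D.description n).Adj (descMap e he r X) (descMap e he r Y) ↔
      if ℓ.flips (r X.1.1) (r Y.1.1) then
        D.HasEdge (ℓ.relabel (r X.1.1) (r Y.1.1)) (e Y.1.1) (e X.1.1)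
      else D.HasEdge (ℓ.relabel (r X.1.1) (r Y.1.1)) (e X.1.1) (e Y.1.1) := by
    have h' := h.relabel hn (fun h => X.2.trans (hr _ h)) (fun h => Y.2.trans (hr _ h))
      (fun h => by rw [hℓ.1 h])
    have hℓ' : (ℓ.relabel (r X.1.1) (r Y.1.1)).IsLoop ↔ e X.1.1 = e Y.1.1 := by
      rw [EdgeLabel.isLoop_relabel, hℓ, he'.eq_iff]
    split_ifs at h' ⊢
    · rw [SimpleGraph.adj_comm]
      exact description_adj_iff_hasEdge (X := descMap e he r Y) (Y := descMap e he r X) hn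
        (hℓ'.trans eq_comm) h'
    · exact description_adj_iff_hasEdge (X := descMap e he r X) (Y := descMap e he r Y) hn hℓ' h'
  constructor
  · intro H X Y
    by_cases hXY : X = Y
    · subst hXY; simp
    obtain ⟨ℓ, hℓ, h | h⟩ := exists_rel_of_ne hXY
    · rw [key hℓ (.inl h), ← H, description_adj_iff_hasEdge hn hℓ (.inl h)]
    · rw [SimpleGraph.adj_comm, SimpleGraph.adj_comm _ (descMap e he r X),
        key (hℓ.trans eq_comm) (.inl h), ← H,
        description_adj_iff_hasEdge hn (hℓ.trans eq_comm) (.inl h)]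
  · intro H ℓ u v
    by_cases hℓ : (ℓ.IsLoop ↔ u = v) ∧ ℓ.ends = s(C.label u, C.label v)
    · obtain ⟨x, y, hx, hy, h⟩ := EdgeLabel.exists_symmRel hn hℓ.2
      rw [← key (X := ⟨(u, x), hx⟩) (Y := ⟨(v, y), hy⟩) hℓ.1 h, ← H,
        description_adj_iff_hasEdge hn (X := ⟨(u, x), hx⟩) (Y := ⟨(v, y), hy⟩) hℓ.1 h]
    -- Relabelling preserves ends and loop status, so a label that does not fit `u` and `v` occurs
    -- on neither side.
    · refine iff_of_false (fun h => hℓ ⟨C.isLoop_iff h, C.ends_eq h⟩) fun h => hℓ ?_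
      split_ifs at h
      · have h1 := D.isLoop_iff h
        have h2 := D.ends_eq h
        rw [EdgeLabel.isLoop_relabel, he'.eq_iff] at h1
        rw [EdgeLabel.ends_relabel, he, he, Sym2.eq_swap] at h2
        exact ⟨h1.trans eq_comm, h2⟩
      · have h1 := D.isLoop_iff h
        have h2 := D.ends_eq h
        rw [EdgeLabel.isLoop_relabel, he'.eq_iff] at h1
        rw [EdgeLabel.ends_relabel, he, he] at h2
        exact ⟨h1, h2⟩

theorem descMap_act (e : C.V → D.V) (he : ∀ v, D.label (e v) = C.label v) (r : C.V → Bool)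
    (σ : Equiv.Perm (Fin n)) (X : C.DescVertex n) :
    descMap e he r (C.act σ X) = D.act σ (descMap e he r X) := by
  simp only [descMap, act, Point.act_eq_map, Point.map_rev]

/-- The equivalence of the vertices of the descriptions given by an isomorphism. -/
def descEquiv (e : C.V ≃ D.V) (he : ∀ v, D.label (e v) = C.label v) (r : C.V → Bool) :
    C.DescVertex n ≃ D.DescVertex n where
  toFun := descMap e he r
  invFun := descMap e.symm (fun v => by rw [← he, e.apply_symm_apply]) (r ∘ e.symm)
  left_inv X := by
    refine Subtype.ext (Prod.ext ?_ ?_)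
    · simp [descMap]
    · simp [descMap, Point.rev_rev]
  right_inv X := by
    refine Subtype.ext (Prod.ext ?_ ?_)
    · simp [descMap]
    · simp [descMap, Point.rev_rev]

/-- Isomorphic classification graphs describe the same FI-graphs. -/
theorem Iso.describes (I : C.Iso D) (hn : 4 ≤ n) {G : FIGraph.{u}} (h : C.Describes G n) :
    D.Describes G n := by
  obtain ⟨φ, hφ⟩ := h
  have H := (hasEdge_iff_iff_description_adj_iff (n := n) hn I.label_eq I.toEquiv.injective
    I.rev_ordered).1 I.hasEdge_iff
  let ψ : C.description n ≃g D.description n :=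
    { descEquiv I.toEquiv I.label_eq I.rev with map_rel_iff' := fun {X Y} => (H X Y).symm }
  refine ⟨ψ.symm.trans φ, fun σ X => ?_⟩
  obtain ⟨Y, rfl⟩ := ψ.surjective X
  have : D.act σ (ψ Y) = ψ (C.act σ Y) := (descMap_act _ I.label_eq I.rev σ Y).symm
  rw [this]
  simp [hφ]

/-- The points over one vertex form a single orbit, so an equivariant map is determined there by one
value. -/
theorem exists_act_eq {X Y : C.DescVertex n} (h : X.1.1 = Y.1.1) :
    ∃ σ : Equiv.Perm (Fin n), C.act σ X = Y := by
  obtain ⟨⟨u, x⟩, hx⟩ := X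
  obtain ⟨⟨v, y⟩, hy⟩ := Y
  obtain rfl : u = v := h
  obtain ⟨f, hf⟩ := Point.exists_map_eq_of_label_eq le_rfl (hx.trans hy.symm)
  refine ⟨Equiv.ofBijective f (Finite.injective_iff_bijective.1 f.injective), ?_⟩
  refine Subtype.ext (Prod.ext rfl ?_)
  simp only [act, Point.act_eq_map]
  refine Eq.trans ?_ hf
  exact congrArg (fun g => Point.map g x) (DFunLike.ext _ _ fun _ => rfl)

/-- A classification graph is determined, up to isomorphism, by its description for one large
value of `n`. -/
theorem nonempty_iso_of_equivariant (hn : 5 ≤ n) (ψ : C.description n ≃g D.description n)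
    (hψ : ∀ (σ : Equiv.Perm (Fin n)) X, ψ (C.act σ X) = D.act σ (ψ X)) :
    Nonempty (C.Iso D) := by
  have hψ' (σ : Equiv.Perm (Fin n)) (X) : ψ.symm (D.act σ X) = C.act σ (ψ.symm X) := by
    rw [ψ.symm_apply_eq, hψ, ψ.apply_symm_apply]
  choose x hx using fun u => Point.exists_label_eq (n := n) (by omega) (C.label u)
  let X (u : C.V) : C.DescVertex n := ⟨(u, x u), hx u⟩
  choose y hy using fun u => Point.exists_label_eq (n := n) (by omega) (D.label u)
  let Y (u : D.V) : D.DescVertex n := ⟨(u, y u), hy u⟩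
  have hX (Z : C.DescVertex n) : (ψ Z).1.1 = (ψ (X Z.1.1)).1.1 := by
    obtain ⟨σ, hσ⟩ := exists_act_eq (X := X Z.1.1) (Y := Z) rfl
    rw [← hσ, hψ]; rfl
  have hY (Z : D.DescVertex n) : (ψ.symm Z).1.1 = (ψ.symm (Y Z.1.1)).1.1 := by
    obtain ⟨σ, hσ⟩ := exists_act_eq (X := Y Z.1.1) (Y := Z) rfl
    rw [← hσ, hψ']; rfl
  let e : C.V ≃ D.V :=
    { toFun := fun u => (ψ (X u)).1.1
      invFun := fun v => (ψ.symm (Y v)).1.1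
      left_inv := fun u => (hY (ψ (X u))).symm.trans (by rw [ψ.symm_apply_apply])
      right_inv := fun v => (hX (ψ.symm (Y v))).symm.trans (by rw [ψ.apply_symm_apply]) }
  -- An equivariant bijection preserves stabilizers, and these determine a point up to reversal.
  have hor (u : C.V) : (ψ (X u)).1.2 = x u ∨ (ψ (X u)).1.2 = (x u).reverse := by
    refine Point.eq_or_eq_reverse_of_stabilizer_eq hn fun σ => ?_
    have h1 : (x u).act σ = x u ↔ C.act σ (X u) = X u := by
      simp [act, X]
    have h2 : (ψ (X u)).1.2.act σ = (ψ (X u)).1.2 ↔ D.act σ (ψ (X u)) = ψ (X u) := by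
      constructor
      · exact fun h => Subtype.ext (Prod.ext rfl h)
      · exact fun h => congrArg (fun Z => Z.1.2) h
    rw [h1, h2, ← hψ, ψ.injective.eq_iff]
  have hor' (u : C.V) : ∃ r : Bool, (r = true → C.label u = .ordered) ∧
      (ψ (X u)).1.2 = (x u).rev r := by
    -- Reversal is recorded only if the point really moves, which forces it to be an ordered pair.
    by_cases h : (ψ (X u)).1.2 = x u
    · exact ⟨false, by simp, h⟩
    · refine ⟨true, fun _ => ?_, (hor u).resolve_left h⟩
      have h' := (hor u).resolve_left h
      rw [← hx]
      rw [h'] at h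
      cases hxu : x u <;> simp [hxu, Point.reverse, Point.label] at h ⊢
  choose r hr hxr using hor'
  have he (u : C.V) : D.label (e u) = C.label u := by
    rw [← hx u, ← Point.label_rev (r u), ← hxr, (ψ (X u)).2]
    rfl
  have hmap (Z : C.DescVertex n) : ψ Z = descMap e he r Z := by
    have h0 : ψ (X Z.1.1) = descMap e he r (X Z.1.1) := Subtype.ext (Prod.ext rfl (hxr _))
    obtain ⟨σ, hσ⟩ := exists_act_eq (X := X Z.1.1) (Y := Z) rfl
    rw [← hσ, hψ, h0, descMap_act]
  refine ⟨⟨e, he, r, hr, ?_⟩⟩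
  refine (hasEdge_iff_iff_description_adj_iff (n := n) (by omega) he e.injective hr).2 fun Z W => ?_
  rw [← hmap, ← hmap, ψ.map_adj_iff]

theorem nonempty_iso_of_describes (hn : 5 ≤ n) {G : FIGraph.{u}} (hC : C.Describes G n)
    (hD : D.Describes G n) : Nonempty (C.Iso D) := by
  obtain ⟨φ, hφ⟩ := hC
  obtain ⟨χ, hχ⟩ := hD
  refine nonempty_iso_of_equivariant hn (φ.trans χ.symm) fun σ X => ?_
  simp only [RelIso.trans_apply, RelIso.symm_apply_eq, hφ, hχ, RelIso.apply_symm_apply]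

end ClassificationGraph

/-! ### Permutation groups containing many transpositions. -/

namespace Equiv.Perm

/-- If `H` contains the transpositions `(i c)` with `i ∉ A`, then it contains all permutations that
fix `A` pointwise. -/
theorem mem_of_forall_mem_apply_eq {α : Type*} [Fintype α] [DecidableEq α]
    {H : Subgroup (Equiv.Perm α)} {A : Finset α} {c : α}
    (hA : ∀ i, i ∉ A → Equiv.swap i c ∈ H) {σ : Equiv.Perm α} (hσ : ∀ i ∈ A, σ i = i) :
    σ ∈ H := by
  have hswap {i j : α} (hi : i ∉ A) (hj : j ∉ A) : Equiv.swap i j ∈ H :=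
    SubmonoidClass.swap_mem_trans H (hA i hi) (by rw [Equiv.swap_comm]; exact hA j hj)
  induction h : σ.support.card using Nat.strong_induction_on generalizing σ with
  | _ k ih =>
    by_cases h1 : σ = 1
    · rw [h1]; exact H.one_mem
    obtain ⟨x, hx⟩ : ∃ x, σ x ≠ x := by
      by_contra! h2
      exact h1 (Equiv.ext h2)
    have hxA : x ∉ A := fun hxA => hx (hσ x hxA)
    have hσx : σ x ∉ A := fun hA' => hx (σ.injective (hσ _ hA'))
    -- Multiplying by this transposition makes `x` fixed and shrinks the support, while `A` stays
    -- fixed pointwise.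
    have key : Equiv.swap x (σ x) * σ ∈ H := by
      refine ih _ (h ▸ Equiv.Perm.card_support_swap_mul hx) (fun i hi => ?_) rfl
      rw [Equiv.Perm.mul_apply, hσ i hi, Equiv.swap_apply_of_ne_of_ne] <;> rintro rfl <;>
        contradiction
    exact (H.mul_mem_cancel_left (hswap hxA hσx)).1 key

/-- If `A` is small and consists of the `i` such that `H` does not contain the transposition
`(i c)`, then `H` preserves `A`. -/
theorem apply_mem_of_mem {α : Type*} [Fintype α] [DecidableEq α]
    {H : Subgroup (Equiv.Perm α)} {A : Finset α} {c : α}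
    (hA : ∀ i, i ∉ A ↔ Equiv.swap i c ∈ H) (hcard : 2 * A.card < Fintype.card α)
    {σ : Equiv.Perm α} (hσ : σ ∈ H) {i : α} (hi : i ∈ A) : σ i ∈ A := by
  -- The size bound provides `t` outside both `A` and its image. If `σ i` were outside `A`, then `(σ
  -- i t)` would lie in `H`; conjugating back makes `i` exchangeable with `σ⁻¹ t ∉ A`, hence with
  -- `c`.
  obtain ⟨t, ht⟩ : ∃ t, t ∉ A ∪ A.map σ.toEmbedding := by
    by_contra! h
    have h1 := Finset.card_union_le A (A.map σ.toEmbedding)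
    rw [Finset.eq_univ_iff_forall.2 h, Finset.card_univ, Finset.card_map] at h1
    omega
  simp only [Finset.mem_union, not_or] at ht
  have ht' : σ⁻¹ t ∉ A := fun h => ht.2 (Finset.mem_map.2 ⟨_, h, by simp⟩)
  by_contra hσi
  have h1 : Equiv.swap (σ i) t ∈ H :=
    SubmonoidClass.swap_mem_trans H ((hA _).1 hσi)
      (by rw [Equiv.swap_comm]; exact (hA _).1 ht.1)
  have h2 : Equiv.swap i (σ⁻¹ t) ∈ H := by
    have := H.mul_mem (H.mul_mem (H.inv_mem hσ) h1) (H.inv_mem (H.inv_mem hσ))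
    have h4 : σ⁻¹ (σ i) = i := σ.symm_apply_apply i
    rwa [← Equiv.swap_apply_apply, h4] at this
  have h3 : Equiv.swap i c ∈ H := SubmonoidClass.swap_mem_trans H h2 ((hA _).1 ht')
  exact (hA i).2 h3 hi

end Equiv.Perm

/-- A subgroup which is large in this sense is the stabilizer of a point. -/
theorem exists_point_of_subgroup {n : ℕ} {H : Subgroup (Equiv.Perm (Fin n))} {A : Finset (Fin n)}
    {c : Fin n} (hA : ∀ i, i ∉ A ↔ Equiv.swap i c ∈ H) (hcard : 2 * A.card < n)
    (h2 : A.card ≤ 2) : ∃ x : Point n, x.supp = A ∧ ∀ σ, σ ∈ H ↔ x.act σ = x := by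
  -- `H` lies between the pointwise and the setwise stabilizer of `A`.
  have hfix {σ : Equiv.Perm (Fin n)} (hσ : ∀ i ∈ A, σ i = i) : σ ∈ H :=
    Equiv.Perm.mem_of_forall_mem_apply_eq (fun i => (hA i).1) hσ
  have hmem {σ : Equiv.Perm (Fin n)} (hσ : σ ∈ H) {i : Fin n} (hi : i ∈ A) : σ i ∈ A :=
    Equiv.Perm.apply_mem_of_mem hA (by rwa [Fintype.card_fin]) hσ hi
  have hcases : A.card = 0 ∨ A.card = 1 ∨ A.card = 2 := by omega
  rcases hcases with h | h | h
  · obtain rfl := Finset.card_eq_zero.1 h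
    exact ⟨.pt, rfl, fun σ => iff_of_true (hfix (by simp)) rfl⟩
  · obtain ⟨a, rfl⟩ := Finset.card_eq_one.1 h
    refine ⟨.elem a, rfl, fun σ => ⟨fun hσ => ?_, fun hσ => hfix ?_⟩⟩
    · simpa [Point.act] using hmem hσ (Finset.mem_singleton_self a)
    · simpa [Point.act] using hσ
  · obtain ⟨a, b, hab, rfl⟩ := Finset.card_eq_two.1 h
    have hor {σ : Equiv.Perm (Fin n)} (ha : σ a ∈ ({a, b} : Finset (Fin n)))
        (hb : σ b ∈ ({a, b} : Finset (Fin n))) : σ a = a ∧ σ b = b ∨ σ a = b ∧ σ b = a := by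
      simp only [Finset.mem_insert, Finset.mem_singleton] at ha hb
      rcases ha with ha | ha <;> rcases hb with hb | hb
      · exact (hab (σ.injective (ha.trans hb.symm))).elim
      · exact .inl ⟨ha, hb⟩
      · exact .inr ⟨ha, hb⟩
      · exact (hab (σ.injective (ha.trans hb.symm))).elim
    have hfix' {σ : Equiv.Perm (Fin n)} (hσ : σ a = a ∧ σ b = b) : σ ∈ H :=
      hfix (by simpa using hσ)
    have hsw {σ : Equiv.Perm (Fin n)} (hσ : σ a = b ∧ σ b = a) : Equiv.swap a b * σ ∈ H :=
      hfix' ⟨by simp [hσ.1], by simp [hσ.2]⟩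
    -- For two elements the pointwise stabilizer has index two in the setwise one, and this
    -- transposition decides which of them `H` is.
    by_cases hs : Equiv.swap a b ∈ H
    · refine ⟨.unordPair {a, b} h, rfl, fun σ => ?_⟩
      simp only [Point.act, Point.unordPair.injEq]
      constructor
      · intro hσ
        refine Finset.map_eq_of_subset fun i hi => ?_
        obtain ⟨j, hj, rfl⟩ := Finset.mem_map.1 hi
        exact hmem hσ hj
      · intro hσ
        have hσ' (i : Fin n) (hi : i ∈ ({a, b} : Finset (Fin n))) :
            σ i ∈ ({a, b} : Finset (Fin n)) := by
          rw [← hσ]; exact Finset.mem_map_of_mem σ.toEmbedding hi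
        rcases hor (hσ' a (by simp)) (hσ' b (by simp)) with h | h
        · exact hfix' h
        · exact (H.mul_mem_cancel_left hs).1 (hsw h)
    · refine ⟨.ordPair a b hab, rfl, fun σ => ?_⟩
      simp only [Point.act, Point.ordPair.injEq]
      refine ⟨fun hσ => ?_, hfix'⟩
      rcases hor (hmem hσ (by simp)) (hmem hσ (by simp)) with h | h
      · exact h
      · exact (hs ((H.mul_mem_cancel_right hσ).1 (hsw h))).elim

instance Point.instFinite (n : ℕ) : Finite (Point n) := by
  -- Points other than ordered pairs are told apart by the second component, of size two, one or
  -- zero.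
  let f : Point n → Option (Fin n × Fin n) × Finset (Fin n)
    | .ordPair a b _ => (some (a, b), ∅)
    | .unordPair s _ => (none, s)
    | .elem a => (none, {a})
    | .pt => (none, ∅)
  refine Finite.of_injective f fun x y h => ?_
  cases x <;> cases y <;> simp_all [f] <;> subst h <;> simp_all

/-- A quadratic polynomial is eventually smaller than the binomial coefficients of higher order. -/
theorem eventually_quadratic_lt_choose (a b c : ℚ) {k : ℕ} (hk : 3 ≤ k) :
    ∀ᶠ n : ℕ in atTop, a * (n : ℚ) ^ 2 + b * (n : ℚ) + c < (n.choose k : ℚ) := by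
  have hpow {j : ℕ} (hj : j < k) (d : ℝ) :
      (fun n : ℕ => d * (n : ℝ) ^ j) =o[atTop] fun n : ℕ => (n : ℝ) ^ k :=
    ((Asymptotics.isLittleO_pow_pow_atTop_of_lt hj).comp_tendsto tendsto_natCast_atTop_atTop).const_mul_left d
  have h := (((hpow (j := 2) (by omega) a).add (hpow (j := 1) (by omega) b)).add
    (hpow (j := 0) (by omega) c)).trans_isTheta (isTheta_choose k).symm
  -- Any constant below one would do: the binomial coefficient is positive, so the bound becomes
  -- strict.
  filter_upwards [h.def (c := 1 / 2) (by norm_num), eventually_ge_atTop k] with n hn hkn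
  have hpos : (0 : ℝ) < n.choose k := by exact_mod_cast Nat.choose_pos hkn
  rw [Real.norm_of_nonneg hpos.le] at hn
  have h1 := (le_abs_self _).trans hn
  have h2 : (a : ℝ) * (n : ℝ) ^ 2 + b * (n : ℝ) + c < (n.choose k : ℝ) := by
    simp only [pow_one, pow_zero, mul_one] at h1
    linarith
  exact_mod_cast h2

/-! ### Orbits of vertices under quadratic growth. -/

namespace FIGraph

variable {G : FIGraph.{u}} {N n : ℕ}

/-- The stabilizer of a vertex of `G_n`. -/
def stabilizer (G : FIGraph.{u}) {n : ℕ} (w : G.V n) : Subgroup (Equiv.Perm (Fin n)) where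
  carrier := {σ | G.map σ.toEmbedding w = w}
  one_mem' := G.map_refl n w
  mul_mem' {σ τ} hσ hτ := by
    have h : (σ * τ).toEmbedding = τ.toEmbedding.trans σ.toEmbedding := rfl
    rw [Set.mem_ofPred_eq, h, G.map_trans, hτ, hσ]
  inv_mem' {σ} hσ := by
    have h : σ.toEmbedding.trans (σ⁻¹).toEmbedding = Function.Embedding.refl _ := by
      ext; simp
    rw [Set.mem_ofPred_eq]
    conv_lhs => rw [← hσ]
    rw [← G.map_trans, h, G.map_refl]

theorem mem_stabilizer {w : G.V n} {σ : Equiv.Perm (Fin n)} :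
    σ ∈ G.stabilizer w ↔ G.map σ.toEmbedding w = w := Iff.rfl

theorem map_perm_eq_iff {w : G.V n} {σ τ : Equiv.Perm (Fin n)} :
    G.map σ.toEmbedding w = G.map τ.toEmbedding w ↔ τ⁻¹ * σ ∈ G.stabilizer w := by
  have h1 : (τ⁻¹ * σ).toEmbedding = σ.toEmbedding.trans (τ⁻¹).toEmbedding := rfl
  have h2 : τ.toEmbedding.trans (τ⁻¹).toEmbedding = Function.Embedding.refl _ := by ext; simp
  have h3 : (τ⁻¹).toEmbedding.trans τ.toEmbedding = Function.Embedding.refl _ := by ext; simp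
  rw [mem_stabilizer, h1, G.map_trans]
  constructor
  · intro h
    rw [h, ← G.map_trans, h2, G.map_refl]
  · intro h
    conv_rhs => rw [← h]
    rw [← G.map_trans, h3, G.map_refl]

/-- In degree `n`, the orbit of the vertex `v` looks like the orbit of the point `z`. -/
def IsModel (G : FIGraph.{u}) {N : ℕ} (v : G.V N) (z : Point N) (n : ℕ) : Prop :=
  ∀ f g : Fin N ↪ Fin n, G.map f v = G.map g v ↔ z.map f = z.map g

/-- Every injection `[N] → [n]` is `ι` followed by a permutation, so equality of images is a
question about the stabilizers of the two images under `ι`. -/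
theorem isModel_of_stabilizer {v : G.V N} {z : Point N} (ι : Fin N ↪ Fin n)
    (h : ∀ σ, σ ∈ G.stabilizer (G.map ι v) ↔ (z.map ι).act σ = z.map ι) : G.IsModel v z n := by
  intro f g
  obtain ⟨σ, rfl⟩ := exists_trans_perm_eq ι f
  obtain ⟨τ, rfl⟩ := exists_trans_perm_eq ι g
  have h1 : (τ⁻¹ * σ).toEmbedding = σ.toEmbedding.trans (τ⁻¹).toEmbedding := rfl
  have h2 : τ.toEmbedding.trans (τ⁻¹).toEmbedding = Function.Embedding.refl _ := by ext; simp
  have h3 : (τ⁻¹).toEmbedding.trans τ.toEmbedding = Function.Embedding.refl _ := by ext; simp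
  rw [G.map_trans, G.map_trans, map_perm_eq_iff, h, Point.act_eq_map, h1, Point.map_trans,
    Point.map_trans, Point.map_trans]
  constructor
  · intro h
    conv_rhs => rw [← h]
    rw [← Point.map_trans (τ⁻¹).toEmbedding τ.toEmbedding, h3, Point.map_refl]
  · intro h
    rw [h, ← Point.map_trans, h2, Point.map_refl]

/-- The stabilizer of the image of `v` preserves a set `A` inside the image of `[N]`, so the orbit
maps onto the subsets of size `A.card`. The bound on the number of vertices then excludes three or
more elements. -/
theorem exists_isModel {v : G.V N} (hn : 2 * N < n)
    (hcard : ∀ k, 3 ≤ k → k ≤ N → Nat.card (G.V n) < n.choose k) :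
    ∃ z, G.IsModel v z n := by
  classical
  let ι : Fin N ↪ Fin n := Fin.castLEEmb (by omega)
  set w := G.map ι v with hw
  set H := G.stabilizer w with hH
  obtain ⟨c, hc⟩ := exists_notMem_of_card_lt (Finset.univ.map ι) (by simp; omega)
  have hcι (j : Fin N) : ι j ≠ c := by
    rintro rfl; exact hc (Finset.mem_map_of_mem ι (Finset.mem_univ j))
  let A : Finset (Fin n) := Finset.univ.filter fun i => Equiv.swap i c ∉ H
  have hA (i : Fin n) : i ∉ A ↔ Equiv.swap i c ∈ H := by simp [A]
  -- If `i` and `c` both lie outside the range of `ι`, then composing `ι` with `(i c)` changes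
  -- nothing.
  have hAι {i : Fin n} (hi : i ∈ A) : i ∈ Set.range ι := by
    by_contra h
    refine (hA i).2 ?_ hi
    rw [hH, mem_stabilizer, hw, ← G.map_trans]
    refine congrArg (fun f => G.map f v) (DFunLike.ext (ι.trans _) ι fun j => Equiv.swap_apply_of_ne_of_ne ?_ (hcι j))
    rintro rfl
    exact h ⟨j, rfl⟩
  have hAN : A.card ≤ N := by
    have : A ⊆ Finset.univ.map ι := fun i hi => by
      obtain ⟨j, rfl⟩ := hAι hi
      simp
    simpa using Finset.card_le_card this
  have hA2 : A.card ≤ 2 := by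
    by_contra hA3
    have hlt := hcard A.card (by omega) hAN
    have hmap (B : {B : Finset (Fin n) // B.card = A.card}) :
        ∃ σ : Equiv.Perm (Fin n), A.map σ.toEmbedding = B.1 := by
      have e : A ≃ B.1 := Finset.equivOfCardEq B.2.symm
      obtain ⟨σ, hσ⟩ := exists_perm_apply_eq (e := fun i : A => (i : Fin n))
        (g := fun i : A => (e i : Fin n)) Subtype.val_injective
        (Subtype.val_injective.comp e.injective)
      refine ⟨σ, Finset.eq_of_subset_of_card_le (fun i hi => ?_) (by simp [B.2])⟩
      obtain ⟨j, hj, rfl⟩ := Finset.mem_map.1 hi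
      have := hσ ⟨j, hj⟩
      simp only at this
      simp [this]
    choose σ hσ using hmap
    have hfin := G.finite n
    -- The subset `B` is recovered from the translate of `w`, because `H` preserves `A`.
    have hinj : Function.Injective fun B => G.map (σ B).toEmbedding w := by
      intro B B' h
      have h1 : (σ B')⁻¹ * σ B ∈ H := map_perm_eq_iff.1 h
      refine Subtype.ext (Finset.eq_of_subset_of_card_le (fun i hi => ?_) (by rw [B.2, B'.2]))
      rw [← hσ] at hi
      obtain ⟨j, hj, rfl⟩ := Finset.mem_map.1 hi
      have h2 := Equiv.Perm.apply_mem_of_mem hA (by rw [Fintype.card_fin]; omega) h1 hj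
      rw [← hσ B']
      exact Finset.mem_map.2 ⟨_, h2, by simp⟩
    have := Nat.card_le_card_of_injective _ hinj
    rw [Nat.card_eq_fintype_card, Fintype.card_finset_len, Fintype.card_fin] at this
    omega
  obtain ⟨x, hxA, hx⟩ := exists_point_of_subgroup hA (by omega) hA2
  obtain ⟨z, rfl⟩ := Point.exists_map_eq_of_supp_subset ι (x := x) (fun i hi => hAι (hxA ▸ hi))
  exact ⟨z, isModel_of_stabilizer ι hx⟩

/-- There are finitely many candidates, so one works in infinitely many degrees. Any large degree
lies between two of these, and the maps between degrees, which need not be injective, still preserve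
equalities; this forces its own candidate to agree up to reversal. -/
theorem eventually_isModel {v : G.V N} (h : ∀ᶠ n in atTop, ∃ z, G.IsModel v z n) :
    ∃ z, ∀ᶠ n in atTop, G.IsModel v z n := by
  obtain ⟨z, hz⟩ : ∃ z, ∃ᶠ n in atTop, G.IsModel v z n := by
    by_contra! hz
    obtain ⟨n, ⟨z, h1⟩, h2⟩ := (h.and (eventually_all.2 hz)).exists
    exact h2 z h1
  refine ⟨z, ?_⟩
  obtain ⟨n₀, hz₀, hn₀⟩ := (hz.and_eventually (eventually_ge_atTop (max 5 N))).exists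
  filter_upwards [h, eventually_ge_atTop n₀] with m ⟨z', hz'⟩ hm
  obtain ⟨n₁, hz₁, hn₁⟩ := (hz.and_eventually (eventually_ge_atTop m)).exists
  -- Equalities pass from `n₀` to `m` for one implication and from `m` to `n₁` for the other; maps
  -- of points are injective, so they can be pulled back.
  have key (f g : Fin N ↪ Fin n₀) : z.map f = z.map g ↔ z'.map f = z'.map g := by
    let e : Fin n₀ ↪ Fin m := Fin.castLEEmb hm
    let e' : Fin m ↪ Fin n₁ := Fin.castLEEmb hn₁
    constructor
    · intro h
      rw [← (Point.map_injective e).eq_iff, ← Point.map_trans, ← Point.map_trans, ← hz',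
        G.map_trans, G.map_trans, (hz₀ f g).2 h]
    · intro h
      rw [← (Point.map_injective e).eq_iff, ← Point.map_trans, ← Point.map_trans, ← hz'] at h
      rw [← (Point.map_injective e).eq_iff, ← (Point.map_injective e').eq_iff]
      simp only [← Point.map_trans]
      rw [← hz₁, G.map_trans _ e', h, ← G.map_trans]
  let ι : Fin N ↪ Fin n₀ := Fin.castLEEmb ((le_max_right _ _).trans hn₀)
  have hor := Point.eq_or_eq_reverse_of_stabilizer_eq (x := z.map ι) (y := z'.map ι)
    ((le_max_left _ _).trans hn₀) fun σ => by
      simp only [Point.act_eq_map, ← Point.map_trans]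
      exact key _ ι
  rw [← Point.map_reverse, (Point.map_injective ι).eq_iff, (Point.map_injective ι).eq_iff] at hor
  rcases hor with rfl | rfl
  · exact hz'
  -- Reversal commutes with injections and is injective, so a point and its reverse model the same
  -- orbit.
  · intro f g
    rw [hz', Point.map_reverse, Point.map_reverse]
    exact (Function.LeftInverse.injective Point.reverse_reverse).eq_iff

end FIGraph

/-! ### Symmetry and transitivity of the edge relations. -/

namespace EdgeLabel

/-- Loops are excluded because `ordLoopChain` is listed in one order only. -/
theorem rel_symm_of_label_eq {n : ℕ} (hn : 4 ≤ n) {ℓ : EdgeLabel} (hℓ : ¬ ℓ.IsLoop)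
    (hd : ℓ ≠ ordOrdFirstSecond) {x y : Point n} (hxy : x.label = y.label) (h : ℓ.Rel x y) :
    ℓ.Rel y x := by
  obtain ⟨f, rfl, rfl⟩ := exists_map_src_tgt hn h
  rw [rel_map_iff]
  simp only [Point.label_map] at hxy
  clear h
  cases ℓ <;> simp [Rel, src, tgt, IsLoop, Point.label] at hℓ hd hxy ⊢

instance instFinite : Finite EdgeLabel := by
  refine Finite.of_injective (fun ℓ : EdgeLabel => (ℓ.src, ℓ.tgt, ℓ.IsLoop)) fun ℓ ℓ' h => ?_
  simp only [Prod.mk.injEq, eq_iff_iff] at h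
  refine eq_of_rel_src_tgt h.2.2.symm ?_
  rw [← h.1, ← h.2.1]
  exact ℓ.rel_src_tgt

/-- The permutations act transitively on the pairs of points joined by edges with a given label. -/
theorem exists_perm_of_rel {n : ℕ} (hn : 4 ≤ n) {ℓ : EdgeLabel} {x y x' y' : Point n}
    (h : ℓ.Rel x y) (h' : ℓ.Rel x' y') :
    ∃ σ : Equiv.Perm (Fin n), x.map σ.toEmbedding = x' ∧ y.map σ.toEmbedding = y' := by
  obtain ⟨f, rfl, rfl⟩ := exists_map_src_tgt hn h
  obtain ⟨g, rfl, rfl⟩ := exists_map_src_tgt hn h'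
  obtain ⟨σ, rfl⟩ := exists_trans_perm_eq f g
  exact ⟨σ, (Point.map_trans _ _ _).symm, (Point.map_trans _ _ _).symm⟩

end EdgeLabel

/-! ### Generators, stable edges and the existence of a description. -/

namespace FIGraph

variable {G : FIGraph.{u}} {N k n : ℕ}

theorem le_of_embedding {m n : ℕ} (f : Fin m ↪ Fin n) : m ≤ n := by
  simpa using Fintype.card_le_of_embedding f

/-- All vertices of `G_n` with `n ≥ N` are images of members of the family. -/
def Generates (G : FIGraph.{u}) {N k : ℕ} (v : Fin k → G.V N) : Prop :=
  ∀ n, N ≤ n → ∀ w : G.V n, ∃ (i : Fin k) (f : Fin N ↪ Fin n), G.map f (v i) = w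

theorem FinitelyGenerated.exists_generates (h : G.FinitelyGenerated) :
    ∃ (k N : ℕ) (v : Fin k → G.V N), G.Generates v := by
  obtain ⟨N, hN⟩ := eventually_atTop.1 h
  have := G.finite N
  obtain ⟨k, ⟨e⟩⟩ := Finite.exists_equiv_fin (G.V N)
  refine ⟨k, N, e.symm, fun n hn => ?_⟩
  induction n, hn using Nat.le_induction with
  | base => exact fun w => ⟨e w, .refl _, by rw [e.symm_apply_apply, G.map_refl]⟩
  | succ n hn ih =>
    intro w
    obtain ⟨w, f, rfl⟩ := hN n hn w
    obtain ⟨i, g, rfl⟩ := ih w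
    exact ⟨i, g.trans f, G.map_trans _ _ _⟩

/-- There is a generating family whose members generate disjoint sets of vertices. -/
theorem FinitelyGenerated.exists_generates_disjoint (h : G.FinitelyGenerated) :
    ∃ (k N : ℕ) (v : Fin k → G.V N), G.Generates v ∧
      ∀ (n : ℕ) (f g : Fin N ↪ Fin n) (i j : Fin k), G.map f (v i) = G.map g (v j) → i = j := by
  classical
  have hex := h.exists_generates
  obtain ⟨N, v, hv⟩ := Nat.find_spec hex
  refine ⟨_, N, v, hv, fun n f g i j hij => ?_⟩
  by_contra hne
  have hNn : N ≤ n := le_of_embedding f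
  generalize hk : Nat.find hex = k at v i j
  cases k with
  | zero => exact i.elim0
  | succ k =>
    -- If two families meet in degree `n`, all generators are moved there along `f` and the `i`-th
    -- is dropped, contradicting minimality: what it generated now comes from the `j`-th.
    refine Nat.find_min hex (m := k) (by omega)
      ⟨n, fun l => G.map f (v (i.succAbove l)), fun m hm w => ?_⟩
    obtain ⟨l, p, rfl⟩ := hv m (hNn.trans hm) w
    by_cases hl : l = i
    · subst hl
      obtain ⟨j, rfl⟩ := Fin.exists_succAbove_eq (Ne.symm hne)
      obtain ⟨q, rfl⟩ := exists_trans_eq hm f p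
      obtain ⟨q', hq'⟩ := exists_trans_eq hm f (g.trans q)
      exact ⟨j, q', by rw [← G.map_trans, hq', G.map_trans, G.map_trans, hij]⟩
    · obtain ⟨l, rfl⟩ := Fin.exists_succAbove_eq hl
      obtain ⟨q, rfl⟩ := exists_trans_eq hm f p
      exact ⟨l, q, (G.map_trans _ _ _).symm⟩

/-- A finitely generated vertex-quadratic FI-graph looks, for large `n`, like a disjoint union of
orbits of points. -/
theorem exists_isModel_family (hfg : G.FinitelyGenerated) (hq : G.VertexQuadratic) :
    ∃ (k N : ℕ) (v : Fin k → G.V N) (z : Fin k → Point N), G.Generates v ∧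
      (∀ (n : ℕ) (f g : Fin N ↪ Fin n) (i j : Fin k),
        G.map f (v i) = G.map g (v j) → i = j) ∧
      ∀ᶠ n in atTop, ∀ i, G.IsModel (v i) (z i) n := by
  obtain ⟨k, N, v, hgen, hdisj⟩ := hfg.exists_generates_disjoint
  obtain ⟨a, b, c, hcard⟩ := hq
  have hlt : ∀ᶠ n in atTop, ∀ l ∈ Finset.Icc 3 N, Nat.card (G.V n) < n.choose l := by
    rw [Filter.eventually_all_finset]
    intro l hl
    filter_upwards [hcard, eventually_quadratic_lt_choose a b c (Finset.mem_Icc.1 hl).1]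
      with n h1 h2
    rw [← h1] at h2
    exact_mod_cast h2
  have hz (i : Fin k) : ∃ z, ∀ᶠ n in atTop, G.IsModel (v i) z n := by
    refine eventually_isModel ?_
    filter_upwards [hlt, eventually_gt_atTop (2 * N)] with n h1 h2
    exact exists_isModel h2 fun l hl hl' => h1 l (Finset.mem_Icc.2 ⟨hl, hl'⟩)
  choose z hz using hz
  exact ⟨k, N, v, z, hgen, hdisj, eventually_all.2 hz⟩

/-- Whether some points in the orbits of `v i` and `v j` in the relation given by a label are
adjacent. -/
def JoinedBy (G : FIGraph.{u}) {N k : ℕ} (v : Fin k → G.V N) (z : Fin k → Point N)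
    (ℓ : EdgeLabel) (i j : Fin k) : Prop :=
  (ℓ.IsLoop ↔ i = j) ∧ ∃ (n : ℕ) (f g : Fin N ↪ Fin n),
    (∀ m, n ≤ m → ∀ i, G.IsModel (v i) (z i) m) ∧ ℓ.Rel ((z i).map f) ((z j).map g) ∧ (G.graph n).Adj (G.map f (v i)) (G.map g (v j))

theorem JoinedBy.ends_eq {v : Fin k → G.V N} {z : Fin k → Point N} {ℓ : EdgeLabel} {i j : Fin k}
    (h : G.JoinedBy v z ℓ i j) : ℓ.ends = s((z i).label, (z j).label) := by
  obtain ⟨-, n, f, g, -, h, -⟩ := h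
  simpa only [Point.label_map] using EdgeLabel.ends_eq_of_rel h

/-- A witness is pushed to degree `n` and moved by a permutation onto any pair with the same label;
both steps preserve adjacency. The model condition turns the resulting equalities of points into
equalities of vertices. -/
theorem JoinedBy.eventually_adj {v : Fin k → G.V N} {z : Fin k → Point N} {ℓ : EdgeLabel}
    {i j : Fin k} (h : G.JoinedBy v z ℓ i j) :
    ∀ᶠ n in atTop, ∀ f g : Fin N ↪ Fin n, ℓ.Rel ((z i).map f) ((z j).map g) →
      (G.graph n).Adj (G.map f (v i)) (G.map g (v j)) := by
  obtain ⟨-, m, f', g', hmod, hrel, hadj⟩ := h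
  filter_upwards [eventually_ge_atTop m, eventually_ge_atTop 4] with n hm h4 f g h
  let e : Fin m ↪ Fin n := Fin.castLEEmb hm
  obtain ⟨σ, h1, h2⟩ := EdgeLabel.exists_perm_of_rel h4 ((ℓ.rel_map_iff e _ _).2 hrel) h
  simp only [← Point.map_trans] at h1 h2
  rw [← hmod n hm] at h1 h2
  rw [← h1, ← h2]
  simp only [G.map_trans]
  exact (G.map _).map_adj ((G.map _).map_adj hadj)

/-- The classification graph of a family of orbits. -/
def classification (G : FIGraph.{u}) {N k : ℕ} (v : Fin k → G.V N) (z : Fin k → Point N) :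
    ClassificationGraph where
  V := Fin k
  finite := inferInstance
  label i := (z i).label
  HasEdge ℓ i j := G.JoinedBy v z ℓ i j ∨ ℓ ≠ .ordOrdFirstSecond ∧ G.JoinedBy v z ℓ j i
  ends_eq := by
    rintro ℓ i j (h | ⟨-, h⟩)
    · exact h.ends_eq
    · rw [Sym2.eq_swap]; exact h.ends_eq
  isLoop_iff := by
    rintro ℓ i j (h | ⟨-, h⟩)
    · exact h.1
    · exact h.1.trans eq_comm
  symm := by
    rintro ℓ i j hℓ (h | ⟨-, h⟩)
    · exact .inr ⟨hℓ, h⟩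
    · exact .inl h

/-- A point `(z i).map f` is sent to `G.map f (v i)`. The model condition makes this well defined
and injective on each orbit, disjointness separates the orbits, and generation gives surjectivity.
-/
theorem eventually_describes {v : Fin k → G.V N} {z : Fin k → Point N} (hgen : G.Generates v)
    (hdisj : ∀ (n : ℕ) (f g : Fin N ↪ Fin n) (i j : Fin k),
      G.map f (v i) = G.map g (v j) → i = j)
    (hmod : ∀ᶠ n in atTop, ∀ i, G.IsModel (v i) (z i) n) :
    ∀ᶠ n in atTop, (G.classification v z).Describes G n := by
  have hadj : ∀ᶠ n in atTop, ∀ (ℓ : EdgeLabel) (i j : Fin k), G.JoinedBy v z ℓ i j →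
      ∀ f g : Fin N ↪ Fin n, ℓ.Rel ((z i).map f) ((z j).map g) →
        (G.graph n).Adj (G.map f (v i)) (G.map g (v j)) := by
    simp only [eventually_all]
    exact fun ℓ i j h => h.eventually_adj
  obtain ⟨M, hM⟩ := eventually_atTop.1 hmod
  filter_upwards [hadj, eventually_ge_atTop M, eventually_ge_atTop (max 4 N)] with n hadj hMn hn
  have h4 : 4 ≤ n := (le_max_left _ _).trans hn
  have hNn : N ≤ n := (le_max_right _ _).trans hn
  set C := G.classification v z with hC
  have hF (X : C.DescVertex n) : ∃ f : Fin N ↪ Fin n, (z X.1.1).map f = X.1.2 :=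
    Point.exists_map_eq_of_label_eq hNn X.2.symm
  choose F hF using hF
  let φ (X : C.DescVertex n) : G.V n := G.map (F X) (v X.1.1)
  have hφ (X : C.DescVertex n) (f : Fin N ↪ Fin n) (h : (z X.1.1).map f = X.1.2) :
      φ X = G.map f (v X.1.1) := (hM n hMn _ _ _).2 ((hF X).trans h.symm)
  have hinj : Function.Injective φ := by
    intro X Y h
    have h1 : X.1.1 = Y.1.1 := hdisj _ _ _ _ _ h
    refine Subtype.ext (Prod.ext h1 ?_)
    rw [← hF X, ← hF Y]
    change G.map (F X) (v X.1.1) = G.map (F Y) (v Y.1.1) at h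
    rw [h1] at h ⊢
    exact (hM n hMn _ _ _).1 h
  have hsurj : Function.Surjective φ := by
    intro w
    obtain ⟨i, f, rfl⟩ := hgen n hNn w
    exact ⟨⟨(i, (z i).map f), Point.label_map _ _⟩, hφ _ _ rfl⟩
  have hequiv (σ : Equiv.Perm (Fin n)) (X : C.DescVertex n) :
      φ (C.act σ X) = G.map σ.toEmbedding (φ X) := by
    rw [hφ (C.act σ X) ((F X).trans σ.toEmbedding), G.map_trans]
    · rfl
    · simp only [ClassificationGraph.act, Point.act_eq_map, ← hF X, Point.map_trans]
  have hadj' {ℓ : EdgeLabel} {X Y : C.DescVertex n} (h : C.HasEdge ℓ X.1.1 Y.1.1)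
      (hrel : ℓ.Rel X.1.2 Y.1.2) : (G.graph n).Adj (φ X) (φ Y) := by
    rcases h with h | ⟨hd, h⟩
    · exact hadj _ _ _ h _ _ (by rwa [hF, hF])
    by_cases hl : ℓ.IsLoop
    · have hXY : Y.1.1 = X.1.1 := h.1.1 hl
      rw [hXY] at h
      have := hadj _ _ _ h (F X) (F Y) (by rwa [← hXY, hF, hXY, hF])
      change (G.graph n).Adj (G.map (F X) (v X.1.1)) (G.map (F Y) (v Y.1.1))
      rwa [hXY]
    -- The label was witnessed from `Y` to `X` but relates `X` to `Y`, so both orbits are of the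
    -- same kind and the relation is symmetric.
    · have hlabel : X.1.2.label = Y.1.2.label := by
        obtain ⟨-, _, _, _, -, h, -⟩ := h
        have h1 := (EdgeLabel.label_eq_of_rel h).1
        rw [Point.label_map] at h1
        rw [(EdgeLabel.label_eq_of_rel hrel).1, Y.2, ← h1]
        rfl
      exact (hadj _ _ _ h (F Y) (F X)
        (by rw [hF, hF]; exact EdgeLabel.rel_symm_of_label_eq h4 hl hd hlabel hrel)).symm
  have hadj_iff (X Y : C.DescVertex n) :
      (G.graph n).Adj (φ X) (φ Y) ↔ (C.description n).Adj X Y := by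
    rw [ClassificationGraph.description_adj_iff]
    constructor
    · intro h
      have hne : X ≠ Y := by rintro rfl; exact (G.graph n).loopless.irrefl _ h
      have hJ {ℓ : EdgeLabel} {X Y : C.DescVertex n} (hl : ℓ.IsLoop ↔ X.1.1 = Y.1.1)
          (hrel : ℓ.Rel X.1.2 Y.1.2) (h : (G.graph n).Adj (φ X) (φ Y)) :
          C.HasEdge ℓ X.1.1 Y.1.1 :=
        -- The adjacent pair is its own witness, since `n` is past the bound `M` for the model
        -- condition.
        .inl ⟨hl, n, F X, F Y, fun m hm => hM m (hMn.trans hm), by rwa [hF, hF], h⟩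
      refine ⟨hne, ?_⟩
      obtain ⟨ℓ, hl, hrel⟩ := ClassificationGraph.exists_rel_of_ne hne
      rcases hrel with hrel | hrel
      · exact .inl ⟨ℓ, hJ hl hrel h, hrel⟩
      · exact .inr ⟨ℓ, hJ (hl.trans eq_comm) hrel h.symm, hrel⟩
    · rintro ⟨-, ⟨ℓ, h1, h2⟩ | ⟨ℓ, h1, h2⟩⟩
      · exact hadj' h1 h2
      · exact (hadj' h1 h2).symm
  exact ⟨{ Equiv.ofBijective φ ⟨hinj, hsurj⟩ with map_rel_iff' := fun {X Y} => hadj_iff X Y },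
    hequiv⟩

end FIGraph

theorem theorem4p3 (G : FIGraph.{u}) (hfg : G.FinitelyGenerated) (hq : G.VertexQuadratic) :
    ∃ C : ClassificationGraph,
      (∀ᶠ n in atTop, C.Describes G n) ∧
      ∀ D : ClassificationGraph, (∀ᶠ n in atTop, D.Describes G n) ↔ Nonempty (C.Iso D) := by
  obtain ⟨k, N, v, z, hgen, hdisj, hmod⟩ := FIGraph.exists_isModel_family hfg hq
  have hC := FIGraph.eventually_describes hgen hdisj hmod
  refine ⟨_, hC, fun D => ⟨fun hD => ?_, fun ⟨I⟩ => ?_⟩⟩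
  -- A single common degree `n ≥ 5` is enough for uniqueness.
  · obtain ⟨n, ⟨h1, h2⟩, hn⟩ := ((hC.and hD).and (eventually_ge_atTop 5)).exists
    exact ClassificationGraph.nonempty_iso_of_describes hn h1 h2
  · filter_upwards [hC, eventually_ge_atTop 4] with n h hn
    exact I.describes hn h
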